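/- Let $k$ be a field of characteristic zero and let $S$ be a set. For a finite subset $F\subseteq S$ let $L(F)$ be the free Lie $k$-algebra on $F$, graded so that every free generator has degree $1$; for $F'\subseteq F$ let $L(F)\to L(F')$ be the morphism that fixes the generators in $F'$ and annihilates those in $F\setminus F'$. Let $$L=L((S)):=\varprojlim_{F} L(F)=\bigoplus_{n\ge 1}\varprojlim_F L(F)_n$$ be the limit in the category of graded Lie algebras, over all finite subsets $F\subseteq S$. Then $L$ is freely generated as a Lie algebra by some set of homogeneous elements. More precisely, let $E_n=\{p\in L : \deg p\le n\}$, let $\langle E_{n-1}\rangle$ be the Lie subalgebra of $L$ generated by $E_{n-1}$, and let $E_n'=E_n\cap\langle E_{n-1}\rangle$. Then for every $n\ge 1$ one can choose a set $X_n\subseteq E_n$ of homogeneous elements that projects bijectively onto a basis of $E_n/E_n'$, and for every such choice of the sets $X_n$ the Lie algebra $L$ is freely generated by $\bigcup_{n\ge1}X_n$. -/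

import Mathlib

noncomputable section

namespace LieLimit

universe u v

section Free

variable (k : Type u) [CommRing k] (X : Type v)

/-- `IsLieMonomial k X n p`: `p` is an iterated bracket, in some arrangement, of `n ≥ 1` free
generators. -/
inductive IsLieMonomial : ℕ → FreeLieAlgebra k X → Prop
  | of (x : X) : IsLieMonomial 1 (FreeLieAlgebra.of k x)
  | lie {m n : ℕ} {p q : FreeLieAlgebra k X} :
      IsLieMonomial m p → IsLieMonomial n q → IsLieMonomial (m + n) ⁅p, q⁆

/-- The degree-`n` component of the free Lie algebra, each free generator having degree `1`. -/
def freePart (n : ℕ) : Submodule k (FreeLieAlgebra k X) :=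
  Submodule.span k {p | IsLieMonomial k X n p}

variable {k X}

theorem lie_mem_freePart {m n : ℕ} {p q : FreeLieAlgebra k X}
    (hp : p ∈ freePart k X m) (hq : q ∈ freePart k X n) : ⁅p, q⁆ ∈ freePart k X (m + n) := by
  induction hp using Submodule.span_induction with
  | zero => simp
  | add a b _ _ ha hb => rw [add_lie]; exact add_mem ha hb
  | smul t a _ ha => rw [smul_lie]; exact Submodule.smul_mem _ t ha
  | mem a ha =>
    induction hq using Submodule.span_induction with
    | zero => simp
    | add b c _ _ hb hc => rw [lie_add]; exact add_mem hb hc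
    | smul t b _ hb => rw [lie_smul]; exact Submodule.smul_mem _ t hb
    | mem b hb => exact Submodule.subset_span (IsLieMonomial.lie ha hb)

end Free

/-- The product of Lie algebras, with the componentwise bracket. -/
instance piLieRing {ι : Type v} (L : ι → Type u) [∀ i, LieRing (L i)] : LieRing (∀ i, L i) where
  bracket p q := fun i => ⁅p i, q i⁆
  add_lie p q r := funext fun i => add_lie (p i) (q i) (r i)
  lie_add p q r := funext fun i => lie_add (p i) (q i) (r i)
  lie_self p := funext fun i => lie_self (p i)
  leibniz_lie p q r := funext fun i => leibniz_lie (p i) (q i) (r i)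

instance piLieAlgebra (k : Type*) [CommRing k] {ι : Type v} (L : ι → Type u) [∀ i, LieRing (L i)]
    [∀ i, LieAlgebra k (L i)] : LieAlgebra k (∀ i, L i) where
  lie_smul t p q := funext fun i => lie_smul t (p i) (q i)

section Limit

variable (k : Type u) [CommRing k] (S : Type v)

open Classical in
/-- The connecting morphism `L(F) → L(G)`, which fixes the generators in `G` and annihilates those
in `F \ G`. (It is used for `G ⊆ F`.) -/
def restrict (F G : Finset S) : FreeLieAlgebra k F →ₗ⁅k⁆ FreeLieAlgebra k G :=
  FreeLieAlgebra.lift k fun s : F =>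
    if h : (s : S) ∈ G then FreeLieAlgebra.of k (⟨s, h⟩ : G) else 0

/-- The limit of the Lie algebras `L(F)`, over the finite subsets `F` of `S`, in the category of
ungraded Lie algebras: the compatible families. -/
def ungradedLimit : LieSubalgebra k (∀ F : Finset S, FreeLieAlgebra k F) where
  carrier := {p | ∀ F G : Finset S, G ⊆ F → restrict k S F G (p F) = p G}
  zero_mem' := fun F G _ => by simp
  add_mem' := fun hp hq F G h => by simp [hp F G h, hq F G h]
  smul_mem' := fun t p hp F G h => by simp [hp F G h]
  lie_mem' := fun {p q} hp hq F G h => by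
    change restrict k S F G ⁅p F, q F⁆ = ⁅p G, q G⁆
    rw [LieHom.map_lie, hp F G h, hq F G h]

/-- The limit of the degree-`n` components `L(F)_n`: compatible families of homogeneous elements
of degree `n`. -/
def limitPart (n : ℕ) : Submodule k (∀ F : Finset S, FreeLieAlgebra k F) :=
  (ungradedLimit k S).toSubmodule ⊓ Submodule.pi Set.univ fun F : Finset S => freePart k F n

variable {k S} in
theorem lie_mem_limitPart {m n : ℕ} {p q : ∀ F : Finset S, FreeLieAlgebra k F}
    (hp : p ∈ limitPart k S m) (hq : q ∈ limitPart k S n) : ⁅p, q⁆ ∈ limitPart k S (m + n) :=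
  ⟨(ungradedLimit k S).lie_mem hp.1 hq.1,
    fun F hF => lie_mem_freePart (hp.2 F hF) (hq.2 F hF)⟩

/-- The limit `L((S))` of the `L(F)` in the category of graded Lie algebras: the sum, over all
degrees `n`, of the limits of the degree-`n` components. -/
def gradedLimit : LieSubalgebra k (∀ F : Finset S, FreeLieAlgebra k F) where
  toSubmodule := ⨆ n, limitPart k S n
  lie_mem' := fun {p q} hp hq => by
    change p ∈ ⨆ n, limitPart k S n at hp
    change q ∈ ⨆ n, limitPart k S n at hq
    change ⁅p, q⁆ ∈ ⨆ n, limitPart k S n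
    induction hp using Submodule.iSup_induction' with
    | zero => simp
    | add a b _ _ ha hb => rw [add_lie]; exact add_mem ha hb
    | mem m a ha =>
      induction hq using Submodule.iSup_induction' with
      | zero => simp
      | add b c _ _ hb hc => rw [lie_add]; exact add_mem hb hc
      | mem n b hb => exact Submodule.mem_iSup_of_mem (m + n) (lie_mem_limitPart ha hb)

/-- The degree-`n` component of `L((S))`. -/
def component (n : ℕ) : Submodule k (gradedLimit k S) :=
  (limitPart k S n).comap (gradedLimit k S).toSubmodule.subtype

variable {k S} in
/-- Homogeneous elements of `L((S))`. -/
def IsHomogeneous (p : gradedLimit k S) : Prop := ∃ n, p ∈ component k S n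

/-- `E_n`: the elements of `L((S))` of degree at most `n`. -/
def degLE (n : ℕ) : Submodule k (gradedLimit k S) :=
  ⨆ i ∈ Set.Iic n, component k S i

/-- `E_{n+1} ∩ ⟨E_n⟩`, where `⟨E_n⟩` is the Lie subalgebra generated by `E_n`. -/
def lowerGenerated (n : ℕ) : Submodule k (gradedLimit k S) :=
  degLE k S (n + 1) ⊓
    (LieSubalgebra.lieSpan k (gradedLimit k S) (degLE k S n : Set (gradedLimit k S))).toSubmodule

variable {k S} in
/-- `X n` is, for every `n ≥ 1`, a set of homogeneous elements of `E_n` that projects bijectively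
to a basis of `E_n / (E_n ∩ ⟨E_{n-1}⟩)`. -/
def IsDegreewiseBasis (X : ℕ → Set (gradedLimit k S)) : Prop :=
  ∀ n : ℕ, (∀ x ∈ X (n + 1), IsHomogeneous x) ∧
    ∃ hX : ∀ x ∈ X (n + 1), x ∈ degLE k S (n + 1),
      ∃ b : Module.Basis (X (n + 1)) k
          (degLE k S (n + 1) ⧸ (lowerGenerated k S n).submoduleOf (degLE k S (n + 1))),
        ∀ x : X (n + 1), b x = Submodule.Quotient.mk ⟨x, hX x x.2⟩

end Limit

/-- The Lie algebra `L` is freely generated by its subset `X`. -/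
def IsFreelyGeneratedBy (k : Type u) [CommRing k] {L : Type v} [LieRing L] [LieAlgebra k L]
    (X : Set L) : Prop :=
  Function.Bijective (FreeLieAlgebra.lift k (fun x : X => (x : L)))

end LieLimit

end

/-! Sending a compatible family of Lie polynomials to its noncommutative power series embeds
`L((S))` into `A = k⟨⟨S⟩⟩`, with primitive image. The core is `rightIndependent_toSeries`: if no
nontrivial linear combination of the degree-`n` members of a homogeneous family `x` lies in the Lie
algebra generated by its members of lower degree, then `∑ x_i b_i = 0` with `b_i ∈ A` forces all
`b_i = 0`. The associative algebra generated by the series of the `x_i` is then free on them. Since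
`FreeLieAlgebra` embeds into `FreeAlgebra` in characteristic zero, the `x_i` are free Lie generators
of what they generate.

Independence goes by induction on the degree. In a relation, fix a word `w` and compare coefficients
at `u ++ w` with `|u| = n` the top degree: the Lie element `y = ∑ b_i(w) x_i`, summed over degree
`n`, lies in the right ideal `∑ x_j A` of the lower `x_j`. Let `φ` be a functional killing `1` and
that ideal, and let `∂_φ` apply `φ` to one factor of the coproduct. By primitivity `∂_φ` commutes
with left multiplication by `y` and by each `x_j`, so `∂_φ y = y ∂_φ 1 = 0`. Duality and the
induction hypothesis then put `y` in the associative algebra generated by the `x_j`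
(`mem_adjoin_of_coderiv_eq_zero`), and Dynkin's operator puts it in the Lie algebra they generate
(`mem_lieSpan_of_toSeries_mem_adjoin`). By hypothesis all `b_i(w)` vanish.

Generation is an induction on the degree filtration. -/

noncomputable section

namespace LieLimit

universe u v

/-! ### The ring of noncommutative power series. -/

/-- Noncommutative formal power series over `k` in the letters `S`. -/
def NCSeries (k : Type u) (S : Type v) : Type (max u v) := List S → k

namespace NCSeries

section Ring

variable {k : Type u} [CommRing k] {S : Type v}

omit [CommRing k] in
@[ext] theorem ext {a b : NCSeries k S} (h : ∀ w : List S, a w = b w) : a = b := funext h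

/-- The power series with given coefficients. -/
def ofCoeff (f : List S → k) : NCSeries k S := f

omit [CommRing k] in
@[simp] theorem ofCoeff_apply (f : List S → k) (w : List S) : ofCoeff f w = f w := rfl

omit [CommRing k] in
@[simp] theorem ofCoeff_eta (a : NCSeries k S) : (ofCoeff fun w => a w) = a := rfl

instance : AddCommGroup (NCSeries k S) := inferInstanceAs (AddCommGroup (List S → k))

instance : Module k (NCSeries k S) := inferInstanceAs (Module k (List S → k))

@[simp] theorem zero_apply (w : List S) : (0 : NCSeries k S) w = 0 := rfl
@[simp] theorem add_apply (a b : NCSeries k S) (w : List S) : (a + b) w = a w + b w := rfl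
@[simp] theorem sub_apply (a b : NCSeries k S) (w : List S) : (a - b) w = a w - b w := rfl
@[simp] theorem smul_apply (t : k) (a : NCSeries k S) (w : List S) : (t • a) w = t * a w := rfl

/-- The coefficient of a word, as a linear form. -/
def coeff (w : List S) : NCSeries k S →ₗ[k] k where
  toFun a := a w
  map_add' _ _ := rfl
  map_smul' _ _ := rfl

@[simp] theorem coeff_apply (w : List S) (a : NCSeries k S) : coeff w a = a w := rfl

theorem sum_apply {ι : Type*} (s : Finset ι) (f : ι → NCSeries k S) (w : List S) :
    (∑ i ∈ s, f i) w = ∑ i ∈ s, f i w :=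
  map_sum (coeff w) f s

/-- The left cofactor of a letter. -/
def shift (s : S) (a : NCSeries k S) : NCSeries k S := fun w => a (s :: w)

omit [CommRing k] in
@[simp] theorem shift_apply (s : S) (a : NCSeries k S) (w : List S) :
    shift s a w = a (s :: w) := rfl

/-- The coefficients of a product. -/
def mulCoeff : List S → NCSeries k S → NCSeries k S → k
  | [], a, b => a [] * b []
  | s :: w, a, b => a [] * b (s :: w) + mulCoeff w (shift s a) b

instance : Mul (NCSeries k S) := ⟨fun a b w => mulCoeff w a b⟩

instance : One (NCSeries k S) := ⟨fun w => if w.isEmpty then 1 else 0⟩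

@[simp] theorem one_nil : (1 : NCSeries k S) [] = 1 := rfl
@[simp] theorem one_cons (s : S) (w : List S) : (1 : NCSeries k S) (s :: w) = 0 := rfl
@[simp] theorem mul_nil (a b : NCSeries k S) : (a * b) [] = a [] * b [] := rfl
theorem mul_cons (a b : NCSeries k S) (s : S) (w : List S) :
    (a * b) (s :: w) = a [] * b (s :: w) + (shift s a * b) w := rfl

theorem shift_mul (s : S) (a b : NCSeries k S) :
    shift s (a * b) = a [] • shift s b + shift s a * b := rfl
@[simp] theorem shift_add (s : S) (a b : NCSeries k S) :
    shift s (a + b) = shift s a + shift s b := rfl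
@[simp] theorem shift_smul (s : S) (t : k) (a : NCSeries k S) :
    shift s (t • a) = t • shift s a := rfl
@[simp] theorem shift_one (s : S) : shift s (1 : NCSeries k S) = 0 := rfl

protected theorem add_mul' (a b c : NCSeries k S) : (a + b) * c = a * c + b * c := by
  ext w
  induction w generalizing a b with
  | nil => simp [add_mul]
  | cons s w ih => simp only [mul_cons, shift_add, ih, add_apply]; ring

protected theorem mul_add' (a b c : NCSeries k S) : a * (b + c) = a * b + a * c := by
  ext w
  induction w generalizing a with
  | nil => simp [mul_add]
  | cons s w ih => simp only [mul_cons, ih, add_apply]; ring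

protected theorem smul_mul' (t : k) (a b : NCSeries k S) : t • a * b = t • (a * b) := by
  ext w
  induction w generalizing a with
  | nil => simp [mul_assoc]
  | cons s w ih => simp only [mul_cons, shift_smul, ih, smul_apply]; ring

protected theorem mul_smul' (t : k) (a b : NCSeries k S) : a * t • b = t • (a * b) := by
  ext w
  induction w generalizing a with
  | nil => simp [mul_left_comm]
  | cons s w ih => simp only [mul_cons, ih, smul_apply]; ring

protected theorem zero_mul' (a : NCSeries k S) : 0 * a = 0 := by
  have := NCSeries.smul_mul' (0 : k) 0 a
  simpa using this

protected theorem mul_zero' (a : NCSeries k S) : a * 0 = 0 := by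
  have := NCSeries.mul_smul' (0 : k) a 0
  simpa using this

protected theorem mul_assoc' (a b c : NCSeries k S) : a * b * c = a * (b * c) := by
  ext w
  induction w generalizing a with
  | nil => simp [mul_assoc]
  | cons s w ih =>
    simp only [mul_cons, shift_mul, NCSeries.add_mul', NCSeries.smul_mul', ih, add_apply,
      smul_apply, mul_nil]
    ring

protected theorem one_mul' (a : NCSeries k S) : 1 * a = a := by
  ext w
  cases w with
  | nil => simp
  | cons s w => simp [mul_cons, NCSeries.zero_mul']

protected theorem mul_one' (a : NCSeries k S) : a * 1 = a := by
  ext w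
  induction w generalizing a with
  | nil => simp
  | cons s w ih => simp [mul_cons, ih]

instance : Ring (NCSeries k S) :=
  { (inferInstance : AddCommGroup (NCSeries k S)) with
    mul := (· * ·)
    one := 1
    left_distrib := NCSeries.mul_add'
    right_distrib := NCSeries.add_mul'
    zero_mul := NCSeries.zero_mul'
    mul_zero := NCSeries.mul_zero'
    mul_assoc := NCSeries.mul_assoc'
    one_mul := NCSeries.one_mul'
    mul_one := NCSeries.mul_one' }

instance : Algebra k (NCSeries k S) :=
  Algebra.ofModule NCSeries.smul_mul' NCSeries.mul_smul'

instance : LieRing (NCSeries k S) := LieRing.ofAssociativeRing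

instance : LieAlgebra k (NCSeries k S) := LieAlgebra.ofAssociativeAlgebra

open Classical in
/-- A letter, as a power series. -/
def letter (s : S) : NCSeries k S := fun w => if w = [s] then 1 else 0

@[simp] theorem letter_nil (s : S) : (letter s : NCSeries k S) [] = 0 := by simp [letter]

theorem shift_letter_self (s : S) : shift s (letter s : NCSeries k S) = 1 := by
  ext w; cases w <;> simp [letter]

theorem shift_letter_of_ne {s t : S} (h : t ≠ s) : shift t (letter s : NCSeries k S) = 0 := by
  ext w; simp [letter, h]

/-- Homogeneous power series of degree `n`. -/
def homogeneous (k : Type u) [CommRing k] (S : Type v) (n : ℕ) : Submodule k (NCSeries k S) where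
  carrier := {a | ∀ w : List S, w.length ≠ n → a w = 0}
  zero_mem' _ _ := rfl
  add_mem' ha hb w hw := by simp [ha w hw, hb w hw]
  smul_mem' t a ha w hw := by simp [ha w hw]

theorem letter_mem_homogeneous (s : S) : letter s ∈ homogeneous k S 1 := by
  intro w hw
  have : w ≠ [s] := by rintro rfl; simp at hw
  simp [letter, this]

theorem shift_mem_homogeneous {n : ℕ} {a : NCSeries k S} (ha : a ∈ homogeneous k S (n + 1))
    (s : S) : shift s a ∈ homogeneous k S n := by
  intro w hw
  exact ha _ (by simpa using hw)

/-- A homogeneous left factor leaves only one splitting of the word in the convolution product. -/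
theorem mul_apply_append {a : NCSeries k S} (b : NCSeries k S) (u v : List S)
    (ha : a ∈ homogeneous k S u.length) : (a * b) (u ++ v) = a u * b v := by
  induction u generalizing a with
  | nil =>
    cases v with
    | nil => simp
    | cons s v =>
      have : shift s a = 0 := by ext w; exact ha _ (by simp)
      simp [mul_cons, this]
  | cons s u ih =>
    have h0 : a [] = 0 := ha _ (by simp)
    rw [List.cons_append, mul_cons, h0, ih (shift_mem_homogeneous ha s)]
    simp

theorem mul_apply_of_length_lt {n : ℕ} {a : NCSeries k S} (ha : a ∈ homogeneous k S n)
    (b : NCSeries k S) {w : List S} (hw : w.length < n) : (a * b) w = 0 := by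
  induction w generalizing a n with
  | nil => simp [ha [] (by simpa using hw.ne)]
  | cons s w ih =>
    obtain ⟨n, rfl⟩ : ∃ m, n = m + 1 := ⟨n - 1, by omega⟩
    rw [mul_cons, ha [] (by simp), ih (shift_mem_homogeneous ha s) (by simpa using hw)]
    simp

theorem mul_apply_of_le {n : ℕ} {a : NCSeries k S} (ha : a ∈ homogeneous k S n)
    (b : NCSeries k S) {w : List S} (hw : n ≤ w.length) :
    (a * b) w = a (w.take n) * b (w.drop n) := by
  have h : (w.take n).length = n := by simpa using hw
  conv_lhs => rw [← List.take_append_drop n w]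
  exact mul_apply_append b _ _ (by rwa [h])

theorem mul_mem_homogeneous {m n : ℕ} {a b : NCSeries k S} (ha : a ∈ homogeneous k S m)
    (hb : b ∈ homogeneous k S n) : a * b ∈ homogeneous k S (m + n) := by
  intro w hw
  rcases lt_or_ge w.length m with h | h
  · exact mul_apply_of_length_lt ha b h
  · rw [mul_apply_of_le ha b h, hb _ (by simp; omega), mul_zero]

theorem lie_mem_homogeneous {m n : ℕ} {a b : NCSeries k S} (ha : a ∈ homogeneous k S m)
    (hb : b ∈ homogeneous k S n) : ⁅a, b⁆ ∈ homogeneous k S (m + n) := by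
  rw [Ring.lie_def]
  exact sub_mem (mul_mem_homogeneous ha hb) (add_comm n m ▸ mul_mem_homogeneous hb ha)

/-! ### Pairing, shuffle coproduct and primitive series. -/

/-- The pairing of power series with polynomials. -/
def pairing (φ : List S →₀ k) : NCSeries k S →ₗ[k] k where
  toFun a := φ.sum fun w t => t * a w
  map_add' a b := by simp [mul_add, Finsupp.sum_add]
  map_smul' t a := by simp [Finsupp.mul_sum, mul_left_comm]

theorem pairing_apply (φ : List S →₀ k) (a : NCSeries k S) :
    pairing φ a = φ.sum fun w t => t * a w := rfl

/-- The coefficient `a (v ⧢ w)` of the coproduct of `a`. -/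
def coprod : List S → List S → NCSeries k S → k
  | [], w, a => a w
  | s :: v, [], a => a (s :: v)
  | s :: v, t :: w, a => coprod v (t :: w) (shift s a) + coprod (s :: v) w (shift t a)
termination_by v w => v.length + w.length

@[simp] theorem coprod_nil_left (w : List S) (a : NCSeries k S) : coprod [] w a = a w := by
  rw [coprod]

@[simp] theorem coprod_nil_right (v : List S) (a : NCSeries k S) : coprod v [] a = a v := by
  cases v <;> rw [coprod]

theorem coprod_cons_cons (s t : S) (v w : List S) (a : NCSeries k S) :
    coprod (s :: v) (t :: w) a = coprod v (t :: w) (shift s a) + coprod (s :: v) w (shift t a) := by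
  rw [coprod]

theorem coprod_linear (v w : List S) :
    (∀ a b : NCSeries k S, coprod v w (a + b) = coprod v w a + coprod v w b) ∧
      ∀ (t : k) (a : NCSeries k S), coprod v w (t • a) = t * coprod v w a := by
  induction v generalizing w with
  | nil => simp
  | cons s v ihv =>
    induction w with
    | nil => simp
    | cons t w ihw =>
      refine ⟨fun a b => ?_, fun r a => ?_⟩
      · simp only [coprod_cons_cons, shift_add, (ihv _).1, ihw.1]; ring
      · simp only [coprod_cons_cons, shift_smul, (ihv _).2, ihw.2]; ring

/-- The coefficient of the coproduct, as a linear form. -/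
def coprodₗ (v w : List S) : NCSeries k S →ₗ[k] k where
  toFun := coprod v w
  map_add' := (coprod_linear v w).1
  map_smul' := (coprod_linear v w).2

@[simp] theorem coprodₗ_apply (v w : List S) (a : NCSeries k S) :
    coprodₗ v w a = coprod v w a := rfl

theorem coprod_one_left_cons (s : S) (v w : List S) :
    coprod (s :: v) w (1 : NCSeries k S) = 0 := by
  cases w with
  | nil => simp
  | cons t w =>
    rw [coprod_cons_cons, shift_one, shift_one, ← coprodₗ_apply, ← coprodₗ_apply]
    simp only [map_zero, add_zero]

/-- `x` is primitive: multiplication by `x` on the left is multiplication by `x ⊗ 1 + 1 ⊗ x` after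
the coproduct. -/
def IsPrimitive (x : NCSeries k S) : Prop :=
  ∀ (c : NCSeries k S) (v w : List S), coprod v w (x * c) =
    (x * (ofCoeff fun w' => coprod v w' c)) w +
      (x * (ofCoeff fun v' => coprod v' w c)) v

/-- The first letter of a shuffle of `v` and `w` comes from `v` or from `w`; this gives the two
summands. -/
theorem isPrimitive_letter (s : S) : IsPrimitive (letter s : NCSeries k S) := by
  intro c v w
  have shift_letter_mul (t : S) (b : NCSeries k S) :
      shift t (letter s * b) = (shift t (letter s : NCSeries k S)) * b := by
    rw [shift_mul]; simp
  cases v with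
  | nil => simp
  | cons t v =>
    cases w with
    | nil => simp
    | cons r w =>
      rw [coprod_cons_cons, shift_letter_mul, shift_letter_mul, mul_cons, mul_cons, letter_nil]
      by_cases ht : t = s <;> by_cases hr : r = s
      all_goals
        try subst ht
        try subst hr
        simp_all [shift_letter_self, shift_letter_of_ne, ← coprodₗ_apply, add_comm]

/-- In the completed tensor square, `x ⊗ 1` and `1 ⊗ y` commute. -/
theorem mul_mul_swap (x y : NCSeries k S) (G : List S → List S → k) (v w : List S) :
    (x * (ofCoeff fun w' => (y * (ofCoeff fun v' => G v' w')) v)) w =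
      (y * (ofCoeff fun v' => (x * (ofCoeff fun w' => G v' w')) w)) v := by
  induction w generalizing x with
  | nil =>
    have : (ofCoeff fun v' => (x * (ofCoeff fun w' => G v' w')) []) =
      x [] • (ofCoeff fun v' => G v' []) := by ext; simp
    rw [this]; simp
  | cons s w ih =>
    have : (ofCoeff fun v' => (x * (ofCoeff fun w' => G v' w')) (s :: w)) =
        x [] • (ofCoeff fun v' => G v' (s :: w)) +
        (ofCoeff fun v' => (shift s x * (ofCoeff fun w' => G v' w')) w) := by
      ext; simp [mul_cons]
    rw [this, mul_cons, ih]
    simp [mul_add]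

/-- The last two terms are the cross terms. Together they are symmetric in `x` and `y`, so they
cancel in the commutator, which is why primitives are closed under the bracket. -/
theorem IsPrimitive.coprod_mul_mul {x y : NCSeries k S} (hx : IsPrimitive x) (hy : IsPrimitive y)
    (c : NCSeries k S) (v w : List S) :
    coprod v w (x * (y * c)) =
      (x * (y * (ofCoeff fun w' => coprod v w' c))) w +
      (x * (y * (ofCoeff fun v' => coprod v' w c))) v +
      ((x * (ofCoeff fun w' => (y * (ofCoeff fun v' => coprod v' w' c)) v)) w +
      (y * (ofCoeff fun w' => (x * (ofCoeff fun v' => coprod v' w' c)) v)) w) := by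
  have h1 : (ofCoeff fun w' => coprod v w' (y * c)) =
      y * (ofCoeff fun w' => coprod v w' c) +
        (ofCoeff fun w' => (y * (ofCoeff fun v' => coprod v' w' c)) v) := by
    ext w'; exact hy c v w'
  have h2 : (ofCoeff fun v' => coprod v' w (y * c)) =
      (ofCoeff fun v' => (y * (ofCoeff fun w' => coprod v' w' c)) w) +
      y * (ofCoeff fun v' => coprod v' w c) := by
    ext v'; exact hy c v' w
  rw [hx, h1, h2, mul_add, mul_add, add_apply, add_apply,
    mul_mul_swap y x (fun v' w' => coprod v' w' c)]
  ring

/-- The primitive power series form a Lie algebra. -/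
def primitives (k : Type u) [CommRing k] (S : Type v) :
    LieSubalgebra k (NCSeries k S) where
  carrier := {x | IsPrimitive x}
  zero_mem' c v w := by simp [← coprodₗ_apply]
  add_mem' {x y} hx hy c v w := by
    rw [add_mul, add_mul, add_mul, (coprod_linear v w).1, hx c v w, hy c v w]
    simp only [add_apply]; ring
  smul_mem' t x hx c v w := by
    rw [smul_mul_assoc, smul_mul_assoc, smul_mul_assoc, (coprod_linear v w).2, hx c v w]
    simp only [smul_apply]; ring
  lie_mem' {x y} hx hy c v w := by
    have h : ∀ b : NCSeries k S, ⁅x, y⁆ * b = x * (y * b) - y * (x * b) := fun b => by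
      rw [Ring.lie_def, sub_mul, mul_assoc, mul_assoc]
    rw [h, h, h, ← coprodₗ_apply, map_sub, coprodₗ_apply, coprodₗ_apply,
      IsPrimitive.coprod_mul_mul hx hy, IsPrimitive.coprod_mul_mul hy hx]
    simp only [sub_apply]; ring

/-! ### Truncation to a set of letters. -/

open Classical in
/-- Setting the letters outside of `F` to zero. -/
def truncFun (F : Set S) (a : NCSeries k S) : NCSeries k S :=
  fun w => if ∀ s ∈ w, s ∈ F then a w else 0

theorem truncFun_apply_of_mem {F : Set S} (a : NCSeries k S) {w : List S}
    (h : ∀ s ∈ w, s ∈ F) : truncFun F a w = a w := if_pos h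

theorem truncFun_apply_of_notMem {F : Set S} (a : NCSeries k S) {w : List S}
    (h : ¬ ∀ s ∈ w, s ∈ F) : truncFun F a w = 0 := if_neg h

theorem shift_truncFun_of_mem {F : Set S} (a : NCSeries k S) {s : S} (h : s ∈ F) :
    shift s (truncFun F a) = truncFun F (shift s a) := by
  ext w
  by_cases hw : ∀ t ∈ w, t ∈ F
  · rw [truncFun_apply_of_mem _ hw, shift_apply, shift_apply, truncFun_apply_of_mem]
    simpa [h] using hw
  · rw [truncFun_apply_of_notMem _ hw, shift_apply, truncFun_apply_of_notMem]
    simpa [h] using hw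

theorem shift_truncFun_of_notMem {F : Set S} (a : NCSeries k S) {s : S} (h : s ∉ F) :
    shift s (truncFun F a) = 0 := by
  ext w
  rw [shift_apply, truncFun_apply_of_notMem _ (by simp [h]), zero_apply]

theorem truncFun_add (F : Set S) (a b : NCSeries k S) :
    truncFun F (a + b) = truncFun F a + truncFun F b := by
  ext w
  by_cases h : ∀ s ∈ w, s ∈ F
  · simp only [truncFun_apply_of_mem _ h, add_apply]
  · simp only [truncFun_apply_of_notMem _ h, add_apply, add_zero]

theorem truncFun_smul (F : Set S) (t : k) (a : NCSeries k S) :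
    truncFun F (t • a) = t • truncFun F a := by
  ext w
  by_cases h : ∀ s ∈ w, s ∈ F
  · simp only [truncFun_apply_of_mem _ h, smul_apply]
  · simp only [truncFun_apply_of_notMem _ h, smul_apply, mul_zero]

/-- Setting the letters outside of `F` to zero, as a morphism of algebras. -/
def trunc (F : Set S) : NCSeries k S →ₐ[k] NCSeries k S :=
  AlgHom.ofLinearMap
    { toFun := truncFun F
      map_add' := truncFun_add F
      map_smul' := truncFun_smul F }
    (by ext w; cases w <;> simp [truncFun])
    (by
      intro a b
      change truncFun F (a * b) = truncFun F a * truncFun F b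
      ext w
      induction w generalizing a with
      | nil => simp [truncFun]
      | cons s w ih =>
        change shift s (truncFun F (a * b)) w = _
        rw [mul_cons]
        by_cases hs : s ∈ F
        · have h : ∀ c : NCSeries k S, truncFun F c (s :: w) = truncFun F (shift s c) w :=
            fun c => congrFun (shift_truncFun_of_mem c hs) w
          rw [shift_truncFun_of_mem _ hs, shift_truncFun_of_mem _ hs, ← ih, shift_mul, h,
            truncFun_add, truncFun_smul]
          simp [truncFun]
        · have h : truncFun F b (s :: w) = 0 := congrFun (shift_truncFun_of_notMem b hs) w
          rw [shift_truncFun_of_notMem _ hs, shift_truncFun_of_notMem _ hs, h]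
          simp)

theorem trunc_apply_of_mem {F : Set S} (a : NCSeries k S) {w : List S}
    (h : ∀ s ∈ w, s ∈ F) : trunc F a w = a w := if_pos h

theorem trunc_apply_of_notMem {F : Set S} (a : NCSeries k S) {w : List S}
    (h : ¬ ∀ s ∈ w, s ∈ F) : trunc F a w = 0 := if_neg h

theorem trunc_trunc (F : Set S) (a : NCSeries k S) : trunc F (trunc F a) = trunc F a := by
  ext w
  by_cases h : ∀ s ∈ w, s ∈ F
  · rw [trunc_apply_of_mem _ h]
  · rw [trunc_apply_of_notMem _ h, trunc_apply_of_notMem _ h]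

theorem trunc_letter_of_mem {F : Set S} {s : S} (hs : s ∈ F) :
    trunc F (letter s : NCSeries k S) = letter s := by
  ext w
  by_cases h : ∀ t ∈ w, t ∈ F
  · rw [trunc_apply_of_mem _ h]
  · have : w ≠ [s] := by rintro rfl; simp [hs] at h
    rw [trunc_apply_of_notMem _ h]; simp [letter, this]

theorem trunc_letter_of_notMem {F : Set S} {s : S} (hs : s ∉ F) :
    trunc F (letter s : NCSeries k S) = 0 := by
  ext w
  by_cases h : ∀ t ∈ w, t ∈ F
  · have : w ≠ [s] := by rintro rfl; simp [hs] at h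
    rw [trunc_apply_of_mem _ h]; simp [letter, this]
  · rw [trunc_apply_of_notMem _ h]; simp

/-- A shuffle of `v` and `w` uses only letters of `v` and `w`. -/
theorem coprod_congr {F : Set S} {a b : NCSeries k S} (h : trunc F a = trunc F b)
    {v w : List S} (hv : ∀ s ∈ v, s ∈ F) (hw : ∀ s ∈ w, s ∈ F) :
    coprod v w a = coprod v w b := by
  have key : ∀ {a b : NCSeries k S}, trunc F a = trunc F b → ∀ {w : List S},
      (∀ s ∈ w, s ∈ F) → a w = b w := fun {a b} h w hw => by
    rw [← trunc_apply_of_mem a hw, h, trunc_apply_of_mem b hw]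
  have hshift : ∀ {a b : NCSeries k S}, trunc F a = trunc F b → ∀ s ∈ F,
      trunc F (shift s a) = trunc F (shift s b) := fun {a b} h s hs => by
    have := congrArg (shift s) h
    exact (shift_truncFun_of_mem a hs).symm.trans (this.trans (shift_truncFun_of_mem b hs))
  induction v generalizing w a b with
  | nil => simpa using key h hw
  | cons s v ihv =>
    induction w generalizing a b with
    | nil => simpa using key h hv
    | cons t w ihw =>
      rw [coprod_cons_cons, coprod_cons_cons,
        ihv (hshift h s (hv s (by simp))) (fun r hr => hv r (by simp [hr])) hw,
        ihw (hshift h t (hw t (by simp))) (fun r hr => hw r (by simp [hr]))]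

/-- Each instance of the defining identity involves only the letters of `v ++ w`, hence one finite
truncation. This reduces primitivity to Lie polynomials in finitely many letters. -/
theorem isPrimitive_of_forall_trunc {x : NCSeries k S}
    (hx : ∀ F : Finset S, IsPrimitive (trunc (F : Set S) x)) : IsPrimitive x := by
  classical
  intro c v w
  set F : Finset S := (v ++ w).toFinset
  have hv : ∀ s ∈ v, s ∈ (F : Set S) := fun s hs => by simp [F, hs]
  have hw : ∀ s ∈ w, s ∈ (F : Set S) := fun s hs => by simp [F, hs]
  have key : ∀ (b : NCSeries k S) {u : List S}, (∀ s ∈ u, s ∈ (F : Set S)) →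
      (x * b) u = (trunc (F : Set S) x * b) u := fun b u hu => by
    rw [← trunc_apply_of_mem (x * b) hu, ← trunc_apply_of_mem (_ * b) hu, map_mul, map_mul,
      trunc_trunc]
  rw [key _ hv, key _ hw, ← hx F c v w]
  refine coprod_congr ?_ hv hw
  rw [map_mul, map_mul, trunc_trunc]

end Ring

end NCSeries

/-! ### Duality with polynomials, and coderivations. -/

namespace NCSeries

section Cofactor

variable {k : Type u} [CommRing k] {S : Type v}

theorem pairing_single (w : List S) (t : k) (a : NCSeries k S) :
    pairing (Finsupp.single w t) a = t * a w := by
  rw [pairing_apply, Finsupp.sum_single_index (zero_mul _)]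

theorem pairing_add_left (φ ψ : List S →₀ k) (a : NCSeries k S) :
    pairing (φ + ψ) a = pairing φ a + pairing ψ a := by
  simp only [pairing_apply]
  exact Finsupp.sum_add_index' (fun _ => zero_mul _) fun _ _ _ => add_mul _ _ _

theorem pairing_zero_left (a : NCSeries k S) : pairing (0 : List S →₀ k) a = 0 := by
  rw [pairing_apply, Finsupp.sum_zero_index]

/-- Power series are the full linear dual of polynomials. -/
theorem eq_pairing (g : (List S →₀ k) →ₗ[k] k) (φ : List S →₀ k) :
    g φ = pairing φ (ofCoeff fun w => g (Finsupp.single w 1)) := by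
  induction φ using Finsupp.induction_linear with
  | zero => rw [map_zero, pairing_zero_left]
  | add φ ψ hφ hψ => rw [map_add, pairing_add_left, hφ, hψ]
  | single w t =>
    rw [pairing_single, ofCoeff_apply, ← smul_eq_mul, ← map_smul, Finsupp.smul_single, smul_eq_mul,
      mul_one]

/-- The transpose, evaluated at a word, of the multiplication by a power series on the left. -/
def cofactor : NCSeries k S → List S → List S →₀ k
  | x, [] => Finsupp.single [] (x [])
  | x, s :: w => Finsupp.single (s :: w) (x []) + cofactor (shift s x) w
termination_by _ w => w

theorem pairing_cofactor (x b : NCSeries k S) (w : List S) :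
    pairing (cofactor x w) b = (x * b) w := by
  induction w generalizing x with
  | nil => rw [cofactor, pairing_single, mul_nil]
  | cons s w ih => rw [cofactor, pairing_add_left, pairing_single, ih, mul_cons]

/-- The transpose of the multiplication by a power series on the left. -/
def cofactorₗ (x : NCSeries k S) : (List S →₀ k) →ₗ[k] (List S →₀ k) :=
  Finsupp.linearCombination k (cofactor x)

theorem pairing_cofactorₗ (x b : NCSeries k S) (φ : List S →₀ k) :
    pairing (cofactorₗ x φ) b = pairing φ (x * b) := by
  induction φ using Finsupp.induction_linear with
  | zero => rw [map_zero, pairing_zero_left, pairing_zero_left]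
  | add φ ψ hφ hψ => rw [map_add, pairing_add_left, hφ, hψ, pairing_add_left]
  | single w t =>
    rw [cofactorₗ, Finsupp.linearCombination_single, pairing_single, ← pairing_cofactor,
      pairing_apply, pairing_apply, Finsupp.sum_smul_index (fun _ => zero_mul _), Finsupp.mul_sum]
    simp only [mul_assoc]

/-- The terms of degree less than `n` of a power series. -/
def cut (n : ℕ) (a : NCSeries k S) : NCSeries k S :=
  ofCoeff fun w => if w.length < n then a w else 0

theorem cut_apply_of_le (a : NCSeries k S) {n : ℕ} {w : List S} (h : n ≤ w.length) :
    cut n a w = 0 := if_neg (by omega)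

theorem cut_apply_of_lt (a : NCSeries k S) {n : ℕ} {w : List S} (h : w.length < n) :
    cut n a w = a w := if_pos h

theorem mul_cut_apply_of_lt {d n : ℕ} {x : NCSeries k S} (hx : x ∈ homogeneous k S d)
    (b : NCSeries k S) {w : List S} (h : w.length < n) : (x * cut (n - d) b) w = (x * b) w := by
  rcases lt_or_ge w.length d with hd | hd
  · rw [mul_apply_of_length_lt hx _ hd, mul_apply_of_length_lt hx _ hd]
  · rw [mul_apply_of_le hx _ hd, mul_apply_of_le hx _ hd, cut_apply_of_lt]
    simp; omega

theorem mul_cut_apply_of_le {d n : ℕ} {x : NCSeries k S} (hx : x ∈ homogeneous k S d)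
    (b : NCSeries k S) {w : List S} (h : n ≤ w.length) : (x * cut (n - d) b) w = 0 := by
  rcases lt_or_ge w.length d with hd | hd
  · rw [mul_apply_of_length_lt hx _ hd]
  · rw [mul_apply_of_le hx _ hd, cut_apply_of_le, mul_zero]
    simp; omega

/-- The operator `(1 ⊗ φ) ∘ Δ`, where `Δ` is the coproduct. -/
def coderiv (φ : List S →₀ k) : NCSeries k S →ₗ[k] NCSeries k S where
  toFun c := ofCoeff fun w => pairing φ (ofCoeff fun v => coprod v w c)
  map_add' a b := by
    ext w
    rw [add_apply, ofCoeff_apply, ofCoeff_apply, ofCoeff_apply, ← map_add]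
    exact congrArg _ (NCSeries.ext fun v => (coprod_linear v w).1 a b)
  map_smul' t a := by
    ext w
    rw [RingHom.id_apply, smul_apply, ofCoeff_apply, ofCoeff_apply, ← smul_eq_mul, ← map_smul]
    exact congrArg _ (NCSeries.ext fun v => (coprod_linear v w).2 t a)

theorem coderiv_apply (φ : List S →₀ k) (c : NCSeries k S) (w : List S) :
    coderiv φ c w = pairing φ (ofCoeff fun v => coprod v w c) := rfl

theorem coderiv_apply_nil (φ : List S →₀ k) (c : NCSeries k S) :
    coderiv φ c [] = pairing φ c := by
  simp [coderiv_apply]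

theorem coderiv_one {φ : List S →₀ k} (hφ : φ [] = 0) : coderiv φ 1 = 0 := by
  ext w
  rw [coderiv_apply, pairing_apply, zero_apply]
  refine Finset.sum_eq_zero fun v _ => ?_
  cases v with
  | nil => simp [hφ]
  | cons s v => simp [coprod_one_left_cons]

/-- Left multiplication on one tensor factor commutes with a functional on the other; `φ` has finite
support, so linearity in `φ` suffices. -/
theorem mul_pairing (x : NCSeries k S) (φ : List S →₀ k) (G : List S → NCSeries k S) :
    x * (ofCoeff fun w => pairing φ (ofCoeff fun v => G v w)) =
      ofCoeff fun w => pairing φ (ofCoeff fun v => (x * G v) w) := by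
  induction φ using Finsupp.induction_linear with
  | zero =>
    have h : (ofCoeff fun _ => 0 : NCSeries k S) = 0 := rfl
    simp only [pairing_zero_left, h, mul_zero]
  | add φ ψ hφ hψ =>
    simp only [pairing_add_left]
    have h : ∀ f g : List S → k, (ofCoeff fun w => f w + g w) = ofCoeff f + ofCoeff g :=
      fun _ _ => rfl
    rw [h, h, mul_add, hφ, hψ]
  | single v t =>
    simp only [pairing_single, ofCoeff_apply]
    have h : ∀ a : NCSeries k S, (ofCoeff fun w => t * a w) = t • a := fun _ => rfl
    rw [h, h, mul_smul_comm]

/-- Of the two terms of `(x ⊗ 1 + 1 ⊗ x) Δ c`, the one multiplying by `x` in the factor seen by `φ`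
is killed, as `φ` vanishes on `xA`. -/
theorem IsPrimitive.coderiv_mul {x : NCSeries k S} (hx : IsPrimitive x) {φ : List S →₀ k}
    (hφ : ∀ b, pairing φ (x * b) = 0) (c : NCSeries k S) :
    coderiv φ (x * c) = x * coderiv φ c := by
  ext w
  have h : (ofCoeff fun v => coprod v w (x * c)) =
      (ofCoeff fun v => (x * (ofCoeff fun w' => coprod v w' c)) w) +
        x * (ofCoeff fun v' => coprod v' w c) := by
    ext v; exact hx c v w
  rw [coderiv_apply, h, map_add, hφ, add_zero]
  exact (congrFun (mul_pairing x φ fun v => ofCoeff fun w' => coprod v w' c) w).symm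

end Cofactor

section Field

variable {k : Type u} [Field k] {S : Type v}

/-- The subspace `k + ∑ x_j A` equals its double annihilator: it is the range of the transpose of a
linear map `T` on polynomials, hence the annihilator of `ker T`. Finiteness of `J` lets a functional
on the product over `J` split into its components. -/
theorem exists_eq_smul_one_add_sum {J : Type*} [Fintype J] (x : J → NCSeries k S)
    {c : NCSeries k S} (h : ∀ φ : List S →₀ k, φ [] = 0 → (∀ j b, pairing φ (x j * b) = 0) →
      pairing φ c = 0) :
    ∃ (t : k) (b : J → NCSeries k S), c = t • (1 : NCSeries k S) + ∑ j, x j * b j := by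
  classical
  set T : (List S →₀ k) →ₗ[k] k × (J → List S →₀ k) :=
    (Finsupp.lapply []).prod (LinearMap.pi fun j => cofactorₗ (x j)) with hT
  -- The series `c`, viewed as a linear form on polynomials, vanishes on `ker T`.
  have hc : Finsupp.linearCombination k (fun w => (c w : k)) ∈
      (LinearMap.ker T).dualAnnihilator := by
    rw [Submodule.mem_dualAnnihilator]
    intro φ hφ
    rw [LinearMap.mem_ker] at hφ
    refine h φ (congrArg Prod.fst hφ) fun j b => ?_
    rw [← pairing_cofactorₗ, show cofactorₗ (x j) φ = 0 from congrFun (congrArg Prod.snd hφ) j,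
      pairing_zero_left]
  rw [← LinearMap.range_dualMap_eq_dualAnnihilator_ker] at hc
  obtain ⟨g, hg⟩ := hc
  let b (j : J) : NCSeries k S := ofCoeff fun u => ((g ∘ₗ LinearMap.inr k k _) ∘ₗ
    LinearMap.single k (fun _ => List S →₀ k) j) (Finsupp.single u 1)
  refine ⟨g (1, 0), b, ?_⟩
  ext w
  have h1 : c w = g (T (Finsupp.single w 1)) := by
    have := LinearMap.congr_fun hg (Finsupp.single w 1)
    rw [Finsupp.linearCombination_single, one_smul] at this
    exact this.symm
  have h2 (j : J) : (x j * b j) w = g (0, Pi.single j (cofactor (x j) w)) := by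
    rw [← pairing_cofactor, ← eq_pairing]; rfl
  have h3 : T (Finsupp.single w 1) = (1 : NCSeries k S) w • ((1 : k), (0 : J → List S →₀ k)) +
      ∑ j, (0, Pi.single j (cofactor (x j) w)) := by
    refine Prod.ext ?_ ?_
    · rw [Prod.fst_add, Prod.fst_sum]
      cases w <;> simp [hT]
    · rw [Prod.snd_add, Prod.snd_sum]
      ext1 j
      simp [hT, Finset.sum_apply, Pi.single_apply, cofactorₗ]
  rw [h1, h3, map_add, map_smul, map_sum, add_apply, sum_apply, smul_apply, smul_eq_mul,
    mul_comm]
  simp only [h2]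

/-- Duality gives `c = t + ∑ x_j b_j`. Applying `∂_φ` gives `∑ x_j ∂_φ b_j = 0`, so independence
passes the hypothesis on to the `b_j`, which may be taken of smaller degree. -/
theorem mem_adjoin_of_coderiv_eq_zero {J : Type*} [Fintype J] {x : J → NCSeries k S} {d : J → ℕ}
    (hx : ∀ j, IsPrimitive (x j)) (hd : ∀ j, x j ∈ homogeneous k S (d j)) (hd' : ∀ j, 1 ≤ d j)
    (hind : ∀ b : J → NCSeries k S, ∑ j, x j * b j = 0 → ∀ j, b j = 0) (n : ℕ)
    {c : NCSeries k S} (hn : ∀ w : List S, n ≤ w.length → c w = 0)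
    (hc : ∀ φ : List S →₀ k, φ [] = 0 → (∀ j b, pairing φ (x j * b) = 0) → coderiv φ c = 0) :
    c ∈ Algebra.adjoin k (Set.range x) := by
  induction n using Nat.strong_induction_on generalizing c with
  | _ n ih =>
  obtain rfl | hpos := Nat.eq_zero_or_pos n
  · rw [show c = 0 from NCSeries.ext fun w => hn w (Nat.zero_le _)]
    exact zero_mem _
  obtain ⟨t, b, hb⟩ := exists_eq_smul_one_add_sum x (c := c) fun φ h1 h2 => by
    rw [← coderiv_apply_nil, hc φ h1 h2, zero_apply]
  -- As `c` has no terms of length at least `n`, each cofactor may be cut at length `n - d j`, which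
  -- is less than `n` because `d j ≥ 1`.
  have hb' : c = t • (1 : NCSeries k S) + ∑ j, x j * cut (n - d j) (b j) := by
    ext w
    rw [add_apply, sum_apply]
    rcases lt_or_ge w.length n with h | h
    · conv_lhs => rw [hb]
      rw [add_apply, sum_apply]
      simp only [mul_cut_apply_of_lt (hd _) _ h]
    · rw [hn w h, Finset.sum_eq_zero fun j _ => mul_cut_apply_of_le (hd j) _ h]
      obtain ⟨s, w, rfl⟩ := List.exists_cons_of_length_pos (hpos.trans_le h)
      simp
  rw [hb']
  refine add_mem (Subalgebra.smul_mem _ (one_mem _) t) (sum_mem fun j _ => mul_mem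
    (Algebra.subset_adjoin ⟨j, rfl⟩) (ih (n - d j) (by have := hd' j; omega)
      (fun w hw => cut_apply_of_le _ hw) fun φ h1 h2 => ?_))
  refine hind (fun j => coderiv φ (cut (n - d j) (b j))) ?_ j
  have := hc φ h1 h2
  rw [hb', map_add, map_smul, coderiv_one h1, smul_zero, zero_add, map_sum] at this
  simpa only [(hx _).coderiv_mul (h2 _)] using this

end Field

end NCSeries

-- Dynkin's operator.

attribute [local instance 100] LieRing.ofAssociativeRing

section Dynkin

variable {k : Type u} [CommRing k] {L : Type*} [LieRing L] [LieAlgebra k L]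

/-- The operator `(c, p) ↦ (0, c e z + [z, p])`. -/
def dynkinOp (e : k) (z : L) : Module.End k (k × L) :=
  LinearMap.inr k k L ∘ₗ ((LinearMap.toSpanSingleton k L (e • z)).coprod (LieAlgebra.ad k L z))

theorem dynkinOp_apply (e : k) (z : L) (a : k × L) :
    dynkinOp e z a = (0, a.1 • e • z + ⁅z, a.2⁆) := by
  simp [dynkinOp]

theorem dynkinOp_add (e : k) (z z' : L) :
    dynkinOp e (z + z') = dynkinOp e z + dynkinOp e z' := by
  refine LinearMap.ext fun a => ?_
  simp only [dynkinOp_apply, LinearMap.add_apply, Prod.mk_add_mk, add_zero, smul_add, add_lie]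
  congr 1; abel

theorem dynkinOp_smul (e t : k) (z : L) : dynkinOp e (t • z) = t • dynkinOp e z := by
  refine LinearMap.ext fun a => ?_
  simp only [dynkinOp_apply, LinearMap.smul_apply, Prod.smul_mk, smul_add, smul_lie, smul_zero]
  rw [smul_comm e t, smul_comm a.1 t]

theorem dynkinOp_zero (e : k) : dynkinOp e (0 : L) = 0 := by
  refine LinearMap.ext fun a => ?_
  simp [dynkinOp_apply]

/-- When `e` is the degree of `z`, this is the adjoint action with `(1, 0)` in the role of `-D`, for
`D` the Euler derivation: `[z, -D] = e z`. The identity is then Jacobi's, with weights adding up. -/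
theorem dynkinOp_lie (e e' : k) (z z' : L) :
    dynkinOp (e + e') ⁅z, z'⁆ = ⁅dynkinOp e z, dynkinOp e' z'⁆ := by
  refine LinearMap.ext fun a => ?_
  rw [Ring.lie_def, LinearMap.sub_apply, Module.End.mul_apply, Module.End.mul_apply]
  simp only [dynkinOp_apply, Prod.mk_sub_mk, sub_zero, zero_smul, zero_add, lie_add, lie_smul,
    add_smul, smul_add, lie_lie]
  rw [← lie_skew z z']
  simp only [smul_neg]
  congr 1; abel

/-- Dynkin's operator: the word `x_1 ⋯ x_r` sends `(1, 0)` to `d_r [x_1, [x_2, …, x_r]]`. -/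
def dynkin {Y : Type*} (d : Y → ℕ) (x : Y → L) : FreeAlgebra k Y →ₐ[k] Module.End k (k × L) :=
  FreeAlgebra.lift k fun y => dynkinOp (d y : k) (x y)

theorem dynkin_ι {Y : Type*} (d : Y → ℕ) (x : Y → L) (y : Y) :
    dynkin d x (FreeAlgebra.ι k y) = dynkinOp (d y : k) (x y) :=
  FreeAlgebra.lift_ι_apply _ _

theorem dynkin_mem_lieSpan {Y : Type*} (d : Y → ℕ) (x : Y → L) (P : FreeAlgebra k Y) (a : k × L)
    (ha : a.2 ∈ LieSubalgebra.lieSpan k L (Set.range x)) :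
    (dynkin d x P a).2 ∈ LieSubalgebra.lieSpan k L (Set.range x) := by
  induction P using FreeAlgebra.induction generalizing a with
  | grade0 r =>
    rw [AlgHom.commutes, Module.algebraMap_end_apply]
    exact (LieSubalgebra.lieSpan k L (Set.range x)).smul_mem r ha
  | grade1 y =>
    have hy : x y ∈ LieSubalgebra.lieSpan k L (Set.range x) :=
      LieSubalgebra.subset_lieSpan ⟨y, rfl⟩
    rw [dynkin_ι, dynkinOp_apply]
    exact add_mem (LieSubalgebra.smul_mem _ _ (LieSubalgebra.smul_mem _ _ hy))
      (LieSubalgebra.lie_mem _ hy ha)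
  | mul P Q hP hQ => rw [map_mul, Module.End.mul_apply]; exact hP _ (hQ _ ha)
  | add P Q hP hQ => rw [map_add, LinearMap.add_apply]; exact add_mem (hP _ ha) (hQ _ ha)

theorem dynkin_map {L' : Type*} [LieRing L'] [LieAlgebra k L'] (f : L →ₗ⁅k⁆ L') {Y : Type*}
    (d : Y → ℕ) (x : Y → L) (P : FreeAlgebra k Y) (a : k × L) :
    dynkin d (fun y => f (x y)) P (a.1, f a.2) =
      ((dynkin d x P a).1, f (dynkin d x P a).2) := by
  induction P using FreeAlgebra.induction generalizing a with
  | grade0 r => simp [AlgHom.commutes, Module.algebraMap_end_apply]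
  | grade1 y => simp [dynkin_ι, dynkinOp_apply]
  | mul P Q hP hQ =>
    rw [map_mul, map_mul, Module.End.mul_apply, Module.End.mul_apply, hQ, hP]
  | add P Q hP hQ => simp [hP, hQ]

end Dynkin

/-! ### The free Lie algebra inside the free associative algebra. -/

section FreeLie

variable (k : Type u) [CommRing k] (X : Type v)

/-- The free Lie algebra in the free associative algebra. -/
def toFreeAlgebra : FreeLieAlgebra k X →ₗ⁅k⁆ FreeAlgebra k X :=
  FreeLieAlgebra.lift k (FreeAlgebra.ι k)

variable {k X}

theorem IsLieMonomial.one_le {n : ℕ} {p : FreeLieAlgebra k X} (h : IsLieMonomial k X n p) :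
    1 ≤ n := by
  induction h with
  | of x => exact le_rfl
  | lie _ _ h _ => omega

variable (k X) in
theorem freePart_zero : freePart k X 0 = ⊥ := by
  rw [freePart, Submodule.span_eq_bot]
  intro p hp
  exact absurd (IsLieMonomial.one_le hp) (by norm_num)

variable (k X) in
theorem iSup_freePart : ⨆ n, freePart k X n = ⊤ := by
  let K : LieSubalgebra k (FreeLieAlgebra k X) :=
    { toSubmodule := ⨆ n, freePart k X n
      lie_mem' := fun {p q} hp hq => by
        change p ∈ ⨆ n, freePart k X n at hp
        change q ∈ ⨆ n, freePart k X n at hq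
        change ⁅p, q⁆ ∈ ⨆ n, freePart k X n
        induction hp using Submodule.iSup_induction' with
        | zero => simp
        | add a b _ _ ha hb => rw [add_lie]; exact add_mem ha hb
        | mem m a ha =>
          induction hq using Submodule.iSup_induction' with
          | zero => simp
          | add b c _ _ hb hc => rw [lie_add]; exact add_mem hb hc
          | mem n b hb => exact Submodule.mem_iSup_of_mem (m + n) (lie_mem_freePart ha hb) }
  let f : FreeLieAlgebra k X →ₗ⁅k⁆ K := FreeLieAlgebra.lift k fun x =>
    ⟨FreeLieAlgebra.of k x,
      Submodule.mem_iSup_of_mem 1 (Submodule.subset_span (IsLieMonomial.of x))⟩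
  have h : K.incl.comp f = LieHom.id := by
    refine FreeLieAlgebra.hom_ext fun x => ?_
    simp [f]
  refine eq_top_iff.mpr fun p _ => ?_
  rw [← LieHom.id_apply (R := k) p, ← h]
  exact (f p).2

/-- The Dynkin–Specht–Wever theorem: evaluated at `(1, 0)`, this says that Dynkin's operator
multiplies a Lie element of degree `n` by `n`. -/
theorem dynkin_comp_toFreeAlgebra {n : ℕ} {q : FreeLieAlgebra k X} (hq : q ∈ freePart k X n) :
    dynkin (fun _ => 1) (FreeLieAlgebra.of k) (toFreeAlgebra k X q) = dynkinOp (n : k) q := by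
  induction hq using Submodule.span_induction with
  | zero => rw [map_zero, map_zero, dynkinOp_zero]
  | add p q _ _ hp hq => rw [map_add, map_add, hp, hq, dynkinOp_add]
  | smul t p _ hp => rw [map_smul, map_smul, hp, dynkinOp_smul]
  | mem q hq =>
    induction hq with
    | of x => rw [toFreeAlgebra, FreeLieAlgebra.lift_of_apply, dynkin_ι]
    | lie _ _ hp hq =>
      rw [Nat.cast_add, dynkinOp_lie, ← hp, ← hq, LieHom.map_lie, Ring.lie_def, Ring.lie_def,
        map_sub, map_mul, map_mul]

/-- Dynkin's operator for the letters is computed through words in the Lie elements `x y`, so its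
values are brackets of the `x y`. -/
theorem dynkin_freeAlgebra_lift {Y : Type*} {d : Y → ℕ} {x : Y → FreeLieAlgebra k X}
    (hx : ∀ y, x y ∈ freePart k X (d y)) (P : FreeAlgebra k Y) :
    dynkin (fun _ => 1) (FreeLieAlgebra.of k)
      (FreeAlgebra.lift k (fun y => toFreeAlgebra k X (x y)) P) = dynkin d x P := by
  have : (dynkin (fun _ => 1) (FreeLieAlgebra.of k)).comp
      (FreeAlgebra.lift k (fun y => toFreeAlgebra k X (x y))) = dynkin d x := by
    refine FreeAlgebra.hom_ext (funext fun y => ?_)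
    simp only [Function.comp_apply, AlgHom.comp_apply, FreeAlgebra.lift_ι_apply]
    rw [dynkin_comp_toFreeAlgebra (hx y), dynkin_ι]
  exact DFunLike.congr_fun this P

end FreeLie

section Field

variable (k : Type u) [Field k] [CharZero k] (X : Type v)

/-- The operator `T` factors through the associative algebra, so it kills the kernel; but the Lie
algebra is a sum of eigenspaces of `T` with eigenvalues `n ≥ 1`, nonzero in characteristic zero.
Eigenspaces for distinct eigenvalues are independent. -/
theorem toFreeAlgebra_injective : Function.Injective (toFreeAlgebra k X) := by
  let T : Module.End k (FreeLieAlgebra k X) :=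
    { toFun := fun q =>
        (dynkin (fun _ => 1) (FreeLieAlgebra.of k) (toFreeAlgebra k X q) (1, 0)).2
      map_add' := fun p q => by simp
      map_smul' := fun t p => by simp }
  have hT (n : ℕ) : freePart k X n ≤ T.eigenspace (n : k) := fun q hq => by
    rw [Module.End.mem_eigenspace_iff]
    change (dynkin (fun _ => 1) (FreeLieAlgebra.of k) (toFreeAlgebra k X q) (1, 0)).2 = _
    rw [dynkin_comp_toFreeAlgebra hq, dynkinOp_apply]
    simp
  rw [injective_iff_map_eq_zero]
  intro q hq
  have h0 : q ∈ T.eigenspace 0 := by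
    rw [Module.End.mem_eigenspace_iff]
    change (dynkin (fun _ => 1) (FreeLieAlgebra.of k) (toFreeAlgebra k X q) (1, 0)).2 = _
    rw [hq, map_zero]
    simp
  have h1 : q ∈ ⨆ (μ : k) (_ : μ ≠ 0), T.eigenspace μ := by
    have : (⨆ n, freePart k X n) ≤ ⨆ (μ : k) (_ : μ ≠ 0), T.eigenspace μ := by
      refine iSup_le fun n => ?_
      obtain rfl | hn := eq_or_ne n 0
      · rw [freePart_zero]; exact bot_le
      · exact (hT n).trans (le_iSup₂_of_le (n : k) (by exact_mod_cast hn) le_rfl)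
    exact this (iSup_freePart k X ▸ Submodule.mem_top)
  exact Submodule.disjoint_def.mp (Module.End.eigenspaces_iSupIndep T 0) q h0 h1

end Field

/-! ### Right independence implies freeness of the generated algebra. -/

namespace NCSeries

section RightIndependent

variable {k : Type u} [Field k] {S : Type v}

/-- Independence over the power series, acting on the right. -/
def RightIndependent {ι : Type*} (x : ι → NCSeries k S) : Prop :=
  ∀ (s : Finset ι) (b : ι → NCSeries k S), ∑ i ∈ s, x i * b i = 0 → ∀ i ∈ s, b i = 0

theorem rightIndependent_letter : RightIndependent (letter : S → NCSeries k S) := by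
  intro s b h i hi
  ext w
  have h1 : (∑ i ∈ s, letter i * b i : NCSeries k S) (i :: w) = 0 := by rw [h, zero_apply]
  rw [sum_apply, Finset.sum_eq_single i] at h1
  · simpa [mul_cons, shift_letter_self] using h1
  · intro j _ hj
    simp [mul_cons, shift_letter_of_ne hj.symm]
  · exact fun h => absurd hi h

theorem RightIndependent.comp {ι κ : Type*} {x : ι → NCSeries k S} (hx : RightIndependent x)
    {f : κ → ι} (hf : Function.Injective f) : RightIndependent (x ∘ f) := by
  classical
  intro s b h i hi
  have := hx (s.image f) (fun j => Function.extend f b 0 j)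
    (by rw [Finset.sum_image hf.injOn]; simpa [hf.extend_apply] using h) (f i)
    (Finset.mem_image_of_mem f hi)
  simpa [hf.extend_apply] using this

/-- The value at `x` of a noncommutative polynomial. -/
def wordEval {ι : Type*} (x : ι → NCSeries k S) : (List ι →₀ k) →ₗ[k] NCSeries k S :=
  Finsupp.linearCombination k fun w => (w.map x).prod

/-- Words are sorted by first letter. Allowing every larger finite set lets a prescribed letter be
added to the sum. -/
theorem exists_wordEval_eq {ι : Type*} (x : ι → NCSeries k S) (f : List ι →₀ k) :
    ∃ s₀ : Finset ι, ∀ s, s₀ ⊆ s → wordEval x f = f [] • (1 : NCSeries k S) +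
      ∑ i ∈ s, x i * wordEval x (f.comapDomain (List.cons i) (List.cons_injective.injOn)) := by
  classical
  induction f using Finsupp.induction_linear with
  | zero => exact ⟨∅, fun s _ => by simp⟩
  | add f g hf hg =>
    obtain ⟨s, hs⟩ := hf
    obtain ⟨t, ht⟩ := hg
    refine ⟨s ∪ t, fun r hr => ?_⟩
    rw [map_add, hs r (Finset.union_subset_left hr), ht r (Finset.union_subset_right hr)]
    have h (i : ι) := Finsupp.comapDomain_add_of_injective (List.cons_injective (a := i)) f g
    simp only [h, map_add, mul_add, Finset.sum_add_distrib, Finsupp.add_apply, add_smul]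
    abel
  | single w t =>
    cases w with
    | nil =>
      refine ⟨∅, fun s _ => ?_⟩
      rw [Finset.sum_eq_zero]
      · simp [wordEval]
      · intro i _
        have : (Finsupp.single ([] : List ι) t).comapDomain (List.cons i)
            (List.cons_injective.injOn) = 0 := by ext v; simp
        rw [this, map_zero, mul_zero]
    | cons j w =>
      refine ⟨{j}, fun s hs => ?_⟩
      rw [Finset.sum_eq_single j]
      · have : (Finsupp.single (j :: w) t).comapDomain (List.cons j)
            (List.cons_injective.injOn) = Finsupp.single w t := by
          ext v; simp [Finsupp.single_apply]
        rw [this]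
        simp [wordEval]
      · intro i _ hi
        have : (Finsupp.single (j :: w) t).comapDomain (List.cons i)
            (List.cons_injective.injOn) = 0 := by ext v; simp [hi.symm]
        rw [this, map_zero, mul_zero]
      · exact fun h => absurd (hs (Finset.mem_singleton_self j)) h

/-- Constant terms give `f [] = 0`; independence then makes every left cofactor of `f` evaluate to
zero, and induction on the word finishes. -/
theorem RightIndependent.wordEval_injective {ι : Type*} {x : ι → NCSeries k S}
    (hx : RightIndependent x) (h0 : ∀ i, x i [] = 0) : Function.Injective (wordEval x) := by
  rw [injective_iff_map_eq_zero]
  intro f hf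
  ext w
  induction w generalizing f with
  | nil =>
    obtain ⟨s, hs⟩ := exists_wordEval_eq x f
    have := congrFun (hf.symm.trans (hs s le_rfl)) []
    simpa [sum_apply, h0] using this.symm
  | cons i w ih =>
    classical
    have hnil : f [] = 0 := by
      obtain ⟨s, hs⟩ := exists_wordEval_eq x f
      have := congrFun (hf.symm.trans (hs s le_rfl)) []
      simpa [sum_apply, h0] using this.symm
    obtain ⟨s, hs⟩ := exists_wordEval_eq x f
    have h := hs (insert i s) (Finset.subset_insert i s)
    rw [hf, hnil, zero_smul, zero_add] at h
    simpa using ih _ (hx _ _ h.symm i (Finset.mem_insert_self i s))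

theorem RightIndependent.lift_injective {ι : Type*} {x : ι → NCSeries k S}
    (hx : RightIndependent x) (h0 : ∀ i, x i [] = 0) :
    Function.Injective (FreeAlgebra.lift k x) := by
  let b := FreeAlgebra.basisFreeMonoid k ι
  have hb : ∀ f : FreeMonoid ι →₀ k, FreeAlgebra.lift k x (b.repr.symm f) = wordEval x f := by
    intro f
    induction f using Finsupp.induction_linear with
    | zero => rw [map_zero, map_zero]; exact (map_zero (wordEval x)).symm
    | add f g hf hg => rw [map_add, map_add, hf, hg]; exact (map_add (wordEval x) _ _).symm
    | single w t =>
      have hw : b w = FreeMonoid.lift (FreeAlgebra.ι k) w := by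
        change FreeAlgebra.equivMonoidAlgebraFreeMonoid.symm (MonoidAlgebra.single w 1) = _
        exact (MonoidAlgebra.lift_single _ _ _).trans (one_smul _ _)
      rw [Module.Basis.repr_symm_single, map_smul, hw, FreeMonoid.lift_apply, map_list_prod,
        List.map_map]
      have : FreeAlgebra.lift k x ∘ FreeAlgebra.ι k = x := FreeAlgebra.ι_comp_lift x
      rw [this]
      exact (Finsupp.linearCombination_single k
        (v := fun w : List ι => (w.map x).prod) t w.toList).symm
  intro p q hpq
  have h : wordEval x (b.repr p) = wordEval x (b.repr q) := by
    refine (hb _).symm.trans (Eq.trans ?_ (hb _))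
    rw [LinearEquiv.symm_apply_apply, LinearEquiv.symm_apply_apply, hpq]
  exact b.repr.injective (hx.wordEval_injective h0 h)

end RightIndependent

end NCSeries

/-! ### The embedding of `L((S))` into power series. -/

open NCSeries

section Series

variable {k : Type u} [CommRing k] {S : Type v}

/-- The free Lie algebra on a finite set of letters, as a Lie algebra of power series. -/
def seriesHom (k : Type u) [CommRing k] {S : Type v} (F : Finset S) :
    FreeLieAlgebra k F →ₗ⁅k⁆ NCSeries k S :=
  FreeLieAlgebra.lift k fun s : F => letter (s : S)

theorem seriesHom_of (F : Finset S) (s : F) :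
    seriesHom k F (FreeLieAlgebra.of k s) = letter (s : S) :=
  FreeLieAlgebra.lift_of_apply _ _

theorem freeAlgebra_lift_toFreeAlgebra {X : Type*} (x : X → NCSeries k S)
    (q : FreeLieAlgebra k X) :
    FreeAlgebra.lift k x (toFreeAlgebra k X q) = FreeLieAlgebra.lift k x q := by
  have : (FreeAlgebra.lift k x).toLieHom.comp (toFreeAlgebra k X) = FreeLieAlgebra.lift k x := by
    refine FreeLieAlgebra.hom_ext fun s => ?_
    rw [LieHom.comp_apply, toFreeAlgebra, FreeLieAlgebra.lift_of_apply,
      FreeLieAlgebra.lift_of_apply]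
    exact FreeAlgebra.lift_ι_apply x s
  exact LieHom.congr_fun this q

theorem trunc_seriesHom (F G : Finset S) (q : FreeLieAlgebra k F) :
    trunc (G : Set S) (seriesHom k F q) = seriesHom k G (restrict k S F G q) := by
  have : (trunc (k := k) (G : Set S)).toLieHom.comp (seriesHom k F) =
      (seriesHom k G).comp (restrict k S F G) := by
    refine FreeLieAlgebra.hom_ext fun s => ?_
    rw [LieHom.comp_apply, LieHom.comp_apply, seriesHom_of, restrict,
      FreeLieAlgebra.lift_of_apply]
    split_ifs with hs
    · rw [seriesHom_of]
      exact trunc_letter_of_mem (by simpa using hs)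
    · rw [map_zero]
      exact trunc_letter_of_notMem (by simpa using hs)
  exact LieHom.congr_fun this q

theorem trunc_seriesHom_self (F : Finset S) (q : FreeLieAlgebra k F) :
    trunc (F : Set S) (seriesHom k F q) = seriesHom k F q := by
  have : (trunc (k := k) (F : Set S)).toLieHom.comp (seriesHom k F) = seriesHom k F := by
    refine FreeLieAlgebra.hom_ext fun s => ?_
    rw [LieHom.comp_apply, seriesHom_of]
    exact trunc_letter_of_mem (by simp)
  exact LieHom.congr_fun this q

theorem seriesHom_mem_primitives (F : Finset S) (q : FreeLieAlgebra k F) :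
    seriesHom k F q ∈ primitives k S := by
  let f : FreeLieAlgebra k F →ₗ⁅k⁆ primitives k S :=
    FreeLieAlgebra.lift k fun s : F => ⟨letter (s : S), isPrimitive_letter (s : S)⟩
  have : (primitives k S).incl.comp f = seriesHom k F := by
    refine FreeLieAlgebra.hom_ext fun s => ?_
    rw [LieHom.comp_apply, seriesHom_of, FreeLieAlgebra.lift_of_apply]
    rfl
  rw [← this]
  exact (f q).2

theorem seriesHom_mem_homogeneous (F : Finset S) {n : ℕ} {q : FreeLieAlgebra k F}
    (hq : q ∈ freePart k F n) : seriesHom k F q ∈ homogeneous k S n := by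
  induction hq using Submodule.span_induction with
  | zero => rw [map_zero]; exact zero_mem _
  | add p q _ _ hp hq => rw [map_add]; exact add_mem hp hq
  | smul t p _ hp => rw [map_smul]; exact Submodule.smul_mem _ t hp
  | mem q hq =>
    induction hq with
    | of x => rw [seriesHom_of]; exact letter_mem_homogeneous _
    | lie _ _ hp hq => rw [LieHom.map_lie]; exact lie_mem_homogeneous hp hq

theorem NCSeries.ext_trunc {a b : NCSeries k S}
    (h : ∀ F : Finset S, trunc (F : Set S) a = trunc (F : Set S) b) : a = b := by
  classical
  ext w
  have hw : ∀ s ∈ w, s ∈ ((w.toFinset : Finset S) : Set S) := fun s hs => by simpa using hs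
  rw [← trunc_apply_of_mem a hw, h, trunc_apply_of_mem b hw]

open Classical in
/-- The power series of a compatible family of Lie polynomials. -/
def familySeries (p : ∀ F : Finset S, FreeLieAlgebra k F) : NCSeries k S :=
  ofCoeff fun w => seriesHom k w.toFinset (p w.toFinset) w

theorem trunc_familySeries {p : ∀ F : Finset S, FreeLieAlgebra k F}
    (hp : p ∈ ungradedLimit k S) (F : Finset S) :
    trunc (F : Set S) (familySeries p) = seriesHom k F (p F) := by
  classical
  ext w
  by_cases h : ∀ s ∈ w, s ∈ (F : Set S)
  · have hF : w.toFinset ⊆ F := fun s hs => by simpa using h s (by simpa using hs)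
    have hw : ∀ s ∈ w, s ∈ ((w.toFinset : Finset S) : Set S) := fun s hs => by simpa using hs
    have h1 := trunc_seriesHom F w.toFinset (p F)
    rw [hp F _ hF] at h1
    rw [trunc_apply_of_mem _ h, ← trunc_apply_of_mem (seriesHom k F (p F)) hw, h1, familySeries,
      ofCoeff_apply]
  · rw [trunc_apply_of_notMem _ h, ← trunc_seriesHom_self, trunc_apply_of_notMem _ h]

theorem mem_ungradedLimit (p : gradedLimit k S) :
    (p : ∀ F : Finset S, FreeLieAlgebra k F) ∈ ungradedLimit k S := by
  have h : (⨆ n, limitPart k S n) ≤ (ungradedLimit k S).toSubmodule :=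
    iSup_le fun n => inf_le_left
  exact h p.2

/-- `L((S))` as a Lie algebra of noncommutative power series. -/
def toSeries (k : Type u) [CommRing k] (S : Type v) : gradedLimit k S →ₗ⁅k⁆ NCSeries k S where
  toFun p := familySeries (p : ∀ F : Finset S, FreeLieAlgebra k F)
  map_add' p q := by
    refine NCSeries.ext_trunc fun F => ?_
    rw [map_add, trunc_familySeries (mem_ungradedLimit _), trunc_familySeries (mem_ungradedLimit _),
      trunc_familySeries (mem_ungradedLimit _)]
    exact map_add (seriesHom k F) _ _
  map_smul' t p := by
    refine NCSeries.ext_trunc fun F => ?_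
    rw [map_smul, trunc_familySeries (mem_ungradedLimit _),
      trunc_familySeries (mem_ungradedLimit _)]
    exact map_smul (seriesHom k F) _ _
  map_lie' {p q} := by
    refine NCSeries.ext_trunc fun F => ?_
    change trunc (F : Set S) (familySeries _) = (trunc (F : Set S)).toLieHom ⁅_, _⁆
    rw [LieHom.map_lie, trunc_familySeries (mem_ungradedLimit _)]
    change _ = ⁅trunc (F : Set S) (familySeries _), trunc (F : Set S) (familySeries _)⁆
    rw [trunc_familySeries (mem_ungradedLimit _), trunc_familySeries (mem_ungradedLimit _)]
    exact LieHom.map_lie (seriesHom k F) _ _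

/-- The projection of `L((S))` to the free Lie algebra on a finite set. -/
def proj (k : Type u) [CommRing k] {S : Type v} (F : Finset S) :
    gradedLimit k S →ₗ⁅k⁆ FreeLieAlgebra k F where
  toFun p := (p : ∀ F : Finset S, FreeLieAlgebra k F) F
  map_add' _ _ := rfl
  map_smul' _ _ := rfl
  map_lie' := rfl

theorem gradedLimit_ext {p q : gradedLimit k S} (h : ∀ F, proj k F p = proj k F q) : p = q :=
  Subtype.ext (funext h)

theorem trunc_toSeries (F : Finset S) (p : gradedLimit k S) :
    trunc (F : Set S) (toSeries k S p) = seriesHom k F (proj k F p) :=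
  trunc_familySeries (mem_ungradedLimit p) F

theorem isPrimitive_toSeries (p : gradedLimit k S) : IsPrimitive (toSeries k S p) :=
  isPrimitive_of_forall_trunc fun F => by
    rw [trunc_toSeries]; exact seriesHom_mem_primitives F _

theorem proj_mem_freePart {n : ℕ} {p : gradedLimit k S} (hp : p ∈ component k S n)
    (F : Finset S) : proj k F p ∈ freePart k F n :=
  hp.2 F (Set.mem_univ F)

theorem toSeries_mem_homogeneous {n : ℕ} {p : gradedLimit k S} (hp : p ∈ component k S n) :
    toSeries k S p ∈ homogeneous k S n := by
  classical
  intro w hw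
  have h : ∀ s ∈ w, s ∈ ((w.toFinset : Finset S) : Set S) := fun s hs => by simpa using hs
  rw [← trunc_apply_of_mem (toSeries k S p) h, trunc_toSeries]
  exact seriesHom_mem_homogeneous _ (proj_mem_freePart hp _) w hw

end Series

section Field

variable {k : Type u} [Field k] [CharZero k] {S : Type v}

omit [CharZero k] in
theorem freeAlgebra_lift_letter_injective (F : Finset S) :
    Function.Injective (FreeAlgebra.lift k fun s : F => (letter (s : S) : NCSeries k S)) :=
  (rightIndependent_letter.comp Subtype.val_injective).lift_injective fun s => letter_nil (s : S)

theorem seriesHom_injective (F : Finset S) : Function.Injective (seriesHom k F) := by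
  intro p q h
  refine toFreeAlgebra_injective k F (freeAlgebra_lift_letter_injective F ?_)
  rwa [freeAlgebra_lift_toFreeAlgebra, freeAlgebra_lift_toFreeAlgebra]

theorem toSeries_injective : Function.Injective (toSeries k S) := by
  intro p q h
  refine gradedLimit_ext fun F => seriesHom_injective F ?_
  rw [← trunc_toSeries, ← trunc_toSeries, h]

/-- Dynkin's operator on a polynomial `P` in the `x y` representing `z` returns `n z` as a
combination of brackets of the `x y`. The identity is checked in each `L(F)`, with the same `P` for
all `F`. -/
theorem mem_lieSpan_of_toSeries_mem_adjoin {Y : Type*} {d : Y → ℕ} {x : Y → gradedLimit k S}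
    (hx : ∀ y, x y ∈ component k S (d y)) {n : ℕ} (hn : 1 ≤ n) {z : gradedLimit k S}
    (hz : z ∈ component k S n)
    (h : toSeries k S z ∈ Algebra.adjoin k (Set.range fun y => toSeries k S (x y))) :
    z ∈ LieSubalgebra.lieSpan k (gradedLimit k S) (Set.range x) := by
  rw [Algebra.adjoin_range_eq_range_freeAlgebra_lift] at h
  obtain ⟨P, hP⟩ := h
  have key : (n : k) • z = (dynkin d x P (1, 0)).2 := by
    refine gradedLimit_ext fun F => ?_
    -- Truncation to `F` turns the identity of series into one in the free algebra on `F`, where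
    -- Dynkin's operator is available.
    have h1 : toFreeAlgebra k F (proj k F z) =
        FreeAlgebra.lift k (fun y => toFreeAlgebra k F (proj k F (x y))) P := by
      refine freeAlgebra_lift_letter_injective F ?_
      rw [freeAlgebra_lift_toFreeAlgebra]
      change seriesHom k F _ = _
      rw [← trunc_toSeries, ← hP]
      change ((trunc (F : Set S)).comp (FreeAlgebra.lift k _)) P =
        ((FreeAlgebra.lift k _).comp (FreeAlgebra.lift k _)) P
      congr 1
      refine FreeAlgebra.hom_ext (funext fun y => ?_)
      simp only [Function.comp_apply, AlgHom.comp_apply, FreeAlgebra.lift_ι_apply]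
      rw [trunc_toSeries, freeAlgebra_lift_toFreeAlgebra]
      rfl
    have h2 := dynkin_comp_toFreeAlgebra (proj_mem_freePart hz F)
    rw [h1, dynkin_freeAlgebra_lift (fun y => proj_mem_freePart (hx y) F)] at h2
    have h3 := dynkin_map (proj k F) d x P (1, 0)
    rw [h2, map_zero, dynkinOp_apply] at h3
    refine Eq.trans ?_ (congrArg Prod.snd h3)
    rw [map_smul]
    simp
  have h5 := dynkin_mem_lieSpan d x P (1, 0) (zero_mem _)
  rw [← key] at h5
  have hn' : (n : k) ≠ 0 := by exact_mod_cast (by omega : n ≠ 0)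
  have := LieSubalgebra.smul_mem _ (n : k)⁻¹ h5
  rwa [smul_smul, inv_mul_cancel₀ hn', one_smul] at this

end Field

/-! ### Right independence of Lie generators. -/

section Independence

variable {k : Type u} [Field k] [CharZero k] {S : Type v}

theorem rightIndependent_toSeries {ι : Type*} {x : ι → gradedLimit k S} {d : ι → ℕ}
    (hx : ∀ i, x i ∈ component k S (d i)) (hd : ∀ i, 1 ≤ d i)
    (hind : ∀ (n : ℕ) (s : Finset ι) (c : ι → k), (∀ i ∈ s, d i = n) →
      ∑ i ∈ s, c i • x i ∈ LieSubalgebra.lieSpan k (gradedLimit k S) (x '' {i | d i < n}) →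
      ∀ i ∈ s, c i = 0) :
    RightIndependent fun i => toSeries k S (x i) := by
  classical
  have hX (i : ι) : toSeries k S (x i) ∈ homogeneous k S (d i) := toSeries_mem_homogeneous (hx i)
  suffices key : ∀ (n : ℕ) (s : Finset ι) (b : ι → NCSeries k S), (∀ i ∈ s, d i < n) →
      ∑ i ∈ s, toSeries k S (x i) * b i = 0 → ∀ i ∈ s, b i = 0 by
    intro s b h
    exact key (s.sup d + 1) s b (fun i hi => Nat.lt_succ_of_le (Finset.le_sup hi)) h
  intro n
  induction n with
  | zero => intro s b hs _ i hi; exact absurd (hs i hi) (by omega)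
  | succ n ih =>
    intro s b hs hb
    set s0 := s.filter fun i => d i < n with hs0
    set s1 := s.filter fun i => ¬ d i < n with hs1
    have hd0 : ∀ i ∈ s0, d i < n := fun i hi => (Finset.mem_filter.mp hi).2
    have hd1 : ∀ i ∈ s1, d i = n := fun i hi => by
      have h := Finset.mem_filter.mp hi
      have := hs i h.1
      omega
    have hsum := (Finset.sum_filter_add_sum_filter_not s (fun i => d i < n)
      fun i => toSeries k S (x i) * b i).trans hb
    rw [← hs0, ← hs1] at hsum
    have hb1 : ∀ i ∈ s1, b i = 0 := by
      intro i hi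
      -- The word `w` is a fixed right-hand end; the coefficients `b i w` are scalars to which
      -- `hind` applies.
      ext w
      refine hind n s1 (fun i => b i w) hd1 ?_ i hi
      set y := ∑ i ∈ s1, b i w • x i with hy
      have hyn : y ∈ component k S n :=
        sum_mem fun i hi => Submodule.smul_mem _ _ (hd1 i hi ▸ hx i)
      have hyX : toSeries k S y = ∑ i ∈ s1, b i w • toSeries k S (x i) := by
        rw [hy, map_sum]; simp only [map_smul]
      -- The lower terms contribute at `u ++ w` as products with these cofactors, obtained from `b
      -- j` by stripping the suffix `w` and keeping the degree `n - d j`.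
      let c (j : s0) : NCSeries k S :=
        ofCoeff fun u => if u.length = n - d j then -b j (u ++ w) else 0
      have hc (j : s0) : c j ∈ homogeneous k S (n - d j) := fun u hu => if_neg hu
      have hyc : toSeries k S y = ∑ j : s0, toSeries k S (x j) * c j := by
        ext u
        by_cases hu : u.length = n
        · have h0 := congrFun hsum (u ++ w)
          change ((∑ i ∈ s0, toSeries k S (x i) * b i : NCSeries k S) +
            (∑ i ∈ s1, toSeries k S (x i) * b i : NCSeries k S)) (u ++ w) = 0 at h0
          rw [NCSeries.add_apply, NCSeries.sum_apply, NCSeries.sum_apply] at h0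
          have e1 : ∀ i ∈ s1, (toSeries k S (x i) * b i) (u ++ w) =
              (b i w • toSeries k S (x i)) u := fun i hi => by
            rw [mul_apply_append _ _ _ (by rw [hu, ← hd1 i hi]; exact hX i),
              NCSeries.smul_apply, mul_comm]
          have e0 : ∀ j : s0, (toSeries k S (x j) * c j) u =
              -(toSeries k S (x j) * b j) (u ++ w) := fun j => by
            have hj := hd0 j j.2
            rw [mul_apply_of_le (hX j) _ (by omega),
              mul_apply_of_le (hX j) _ (by rw [List.length_append]; omega),
              List.take_append_of_le_length (by omega), List.drop_append_of_le_length (by omega),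
              ← mul_neg]
            congr 1
            exact if_pos (by rw [List.length_drop, hu])
          rw [hyX, NCSeries.sum_apply, NCSeries.sum_apply, Finset.sum_congr rfl fun j _ => e0 j,
            ← Finset.sum_congr rfl e1, Finset.sum_neg_distrib,
            Finset.sum_coe_sort s0 fun i => (toSeries k S (x i) * b i) (u ++ w)]
          linear_combination h0
        · rw [toSeries_mem_homogeneous hyn u hu, NCSeries.sum_apply, Finset.sum_eq_zero]
          intro j _
          refine mul_mem_homogeneous (hX j) (hc j) u ?_
          have := hd0 j j.2
          omega
      have hadj : toSeries k S y ∈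
          Algebra.adjoin k (Set.range fun j : s0 => toSeries k S (x j)) := by
        refine mem_adjoin_of_coderiv_eq_zero (x := fun j : s0 => toSeries k S (x j))
          (d := fun j : s0 => d j) (fun j => isPrimitive_toSeries (x j))
          (fun j => hX j) (fun j => hd j) ?_ (n + 1)
          (fun u hu => toSeries_mem_homogeneous hyn u (by omega)) fun φ h1 h2 => ?_
        · intro b' hb' j
          have := ih s0 (Function.extend Subtype.val b' 0) hd0 ?_ j j.2
          · rwa [Subtype.val_injective.extend_apply] at this
          · rw [← Finset.sum_coe_sort]
            simpa only [Subtype.val_injective.extend_apply] using hb'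
        -- The right ideal of the lower `x j` contains `y A`, so `∂_φ` commutes with left
        -- multiplication by `y`, and `∂_φ y = y ∂_φ 1 = 0`.
        · have h3 : ∀ a, pairing φ (toSeries k S y * a) = 0 := fun a => by
            rw [hyc, Finset.sum_mul, map_sum]
            exact Finset.sum_eq_zero fun j _ => by rw [mul_assoc, h2]
          rw [← mul_one (toSeries k S y), (isPrimitive_toSeries y).coderiv_mul h3,
            coderiv_one h1, mul_zero]
      have hn : 1 ≤ n := hd1 i hi ▸ hd i
      refine LieSubalgebra.lieSpan_mono ?_
        (mem_lieSpan_of_toSeries_mem_adjoin (fun j : s0 => hx j) hn hyn hadj)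
      rintro _ ⟨j, rfl⟩
      exact ⟨j, hd0 j j.2, rfl⟩
    rw [Finset.sum_eq_zero (s := s1) fun i hi => by rw [hb1 i hi, mul_zero], add_zero] at hsum
    have hb0 := ih s0 b hd0 hsum
    intro i hi
    by_cases h : d i < n
    · exact hb0 i (Finset.mem_filter.mpr ⟨hi, h⟩)
    · exact hb1 i (Finset.mem_filter.mpr ⟨hi, h⟩)

theorem lift_injective_of_independent {ι : Type*} {x : ι → gradedLimit k S} {d : ι → ℕ}
    (hx : ∀ i, x i ∈ component k S (d i)) (hd : ∀ i, 1 ≤ d i)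
    (hind : ∀ (n : ℕ) (s : Finset ι) (c : ι → k), (∀ i ∈ s, d i = n) →
      ∑ i ∈ s, c i • x i ∈ LieSubalgebra.lieSpan k (gradedLimit k S) (x '' {i | d i < n}) →
      ∀ i ∈ s, c i = 0) :
    Function.Injective (FreeLieAlgebra.lift k x) := by
  have h := (rightIndependent_toSeries hx hd hind).lift_injective fun i =>
    toSeries_mem_homogeneous (hx i) [] (by simpa using (Nat.one_le_iff_ne_zero.mp (hd i)).symm)
  have h1 : (toSeries k S).comp (FreeLieAlgebra.lift k x) =
      FreeLieAlgebra.lift k fun i => toSeries k S (x i) :=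
    FreeLieAlgebra.hom_ext fun i => by
      rw [LieHom.comp_apply, FreeLieAlgebra.lift_of_apply, FreeLieAlgebra.lift_of_apply]
  intro p q hpq
  refine toFreeAlgebra_injective k ι (h ?_)
  rw [freeAlgebra_lift_toFreeAlgebra, freeAlgebra_lift_toFreeAlgebra, ← h1, LieHom.comp_apply,
    LieHom.comp_apply, hpq]

end Independence

/-! ### The degree filtration and generation. -/

section Degree

variable {k : Type u} [CommRing k] {S : Type v}

theorem component_le_degLE {m n : ℕ} (h : m ≤ n) : component k S m ≤ degLE k S n :=
  le_iSup₂_of_le m h le_rfl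

theorem degLE_mono {m n : ℕ} (h : m ≤ n) : degLE k S m ≤ degLE k S n :=
  iSup₂_le fun _ hi => component_le_degLE (le_trans hi h)

theorem degLE_succ_le (n : ℕ) : degLE k S (n + 1) ≤ degLE k S n ⊔ component k S (n + 1) := by
  refine iSup₂_le fun i hi => ?_
  obtain h | h := Nat.le_succ_iff.mp hi
  · exact (component_le_degLE h).trans le_sup_left
  · exact h ▸ le_sup_right

theorem degLE_le_lowerGenerated (n : ℕ) : degLE k S n ≤ lowerGenerated k S n :=
  le_inf (degLE_mono n.le_succ) fun _ hp => LieSubalgebra.subset_lieSpan hp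

theorem component_zero : component k S 0 = ⊥ := by
  rw [eq_bot_iff]
  intro p hp
  refine gradedLimit_ext fun F => ?_
  have := proj_mem_freePart hp F
  rwa [freePart_zero, Submodule.mem_bot] at this

theorem degLE_zero : degLE k S 0 = ⊥ := by
  rw [eq_bot_iff]
  refine iSup₂_le fun i hi => ?_
  obtain rfl : i = 0 := Nat.le_zero.mp hi
  exact component_zero.le

variable (k S) in
theorem iSup_component : ⨆ n, component k S n = ⊤ := by
  have h : (⨆ n, component k S n).map (gradedLimit k S).toSubmodule.subtype =
      (gradedLimit k S).toSubmodule := by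
    rw [Submodule.map_iSup]
    have : ∀ n, (component k S n).map (gradedLimit k S).toSubmodule.subtype = limitPart k S n :=
      fun n => by
        rw [component, Submodule.map_comap_subtype, inf_eq_right]
        exact le_iSup (limitPart k S) n
    simp only [this]
    rfl
  refine eq_top_iff.mpr fun p _ => ?_
  have hp : (p : ∀ F : Finset S, FreeLieAlgebra k F) ∈ (gradedLimit k S).toSubmodule := p.2
  rw [← h] at hp
  obtain ⟨q, hq, hqp⟩ := hp
  rwa [← show q = p from Subtype.ext hqp]

theorem toSeries_apply_of_mem_degLE {n : ℕ} {p : gradedLimit k S} (hp : p ∈ degLE k S n)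
    {w : List S} (hw : n < w.length) : toSeries k S p w = 0 := by
  have h : degLE k S n ≤
      LinearMap.ker (coeff w ∘ₗ ((toSeries k S : gradedLimit k S →ₗ⁅k⁆ NCSeries k S) :
        gradedLimit k S →ₗ[k] NCSeries k S)) :=
    iSup₂_le fun i hi p hp => toSeries_mem_homogeneous hp w (lt_of_le_of_lt hi hw).ne'
  exact h hp

/-- Modulo `⟨E_n⟩`, which lies in `K` by induction, every element of `E_{n+1}` is a combination of
`X (n + 1)`. -/
theorem IsDegreewiseBasis.eq_top {X : ℕ → Set (gradedLimit k S)} (hX : IsDegreewiseBasis X)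
    {K : LieSubalgebra k (gradedLimit k S)} (hK : ∀ n, X (n + 1) ⊆ K) : K = ⊤ := by
  have key (n : ℕ) : degLE k S n ≤ K.toSubmodule := by
    induction n with
    | zero => rw [degLE_zero]; exact bot_le
    | succ n ih =>
      intro y hy
      let Q := (lowerGenerated k S n).submoduleOf (degLE k S (n + 1))
      obtain ⟨hmem, (b : Module.Basis _ k (_ ⧸ Q)), hb⟩ := (hX n).2
      set f := b.repr (Q.mkQ ⟨y, hy⟩)
      let g : degLE k S (n + 1) := f.sum fun x t => t • (⟨x, hmem x x.2⟩ : degLE k S (n + 1))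
      have hg : Q.mkQ g = Q.mkQ ⟨y, hy⟩ := by
        rw [← b.linearCombination_repr (Q.mkQ ⟨y, hy⟩), Finsupp.linearCombination_apply,
          map_finsuppSum]
        refine Finsupp.sum_congr fun x _ => ?_
        rw [map_smul, hb]
        rfl
      have h1 : y - (g : gradedLimit k S) ∈ lowerGenerated k S n :=
        (Submodule.Quotient.eq Q).mp hg.symm
      have h2 : y - (g : gradedLimit k S) ∈ K := LieSubalgebra.lieSpan_le.mpr ih h1.2
      have h3 : (g : gradedLimit k S) ∈ K := by
        change (degLE k S (n + 1)).subtype g ∈ K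
        rw [map_finsuppSum]
        exact sum_mem fun x _ => K.smul_mem _ (hK n x.2)
      exact (sub_add_cancel y (g : gradedLimit k S)) ▸ add_mem h2 h3
  refine eq_top_iff.mpr fun p _ => ?_
  have h : (⨆ n, component k S n) ≤ K.toSubmodule :=
    iSup_le fun n => (component_le_degLE le_rfl).trans (key n)
  rw [iSup_component] at h
  exact h Submodule.mem_top

end Degree

/-! ### Degreewise bases: existence and freeness. -/

section Field

variable {k : Type u} [Field k] {S : Type v}

variable (k S) in
theorem exists_isDegreewiseBasis :
    ∃ X : ℕ → Set (gradedLimit k S), IsDegreewiseBasis X := by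
  have key (n : ℕ) : ∃ Y : Set (gradedLimit k S), (∀ x ∈ Y, IsHomogeneous x) ∧
      ∃ hY : ∀ x ∈ Y, x ∈ degLE k S (n + 1),
      ∃ b : Module.Basis Y k
          (degLE k S (n + 1) ⧸ (lowerGenerated k S n).submoduleOf (degLE k S (n + 1))),
        ∀ x : Y, b x = Submodule.Quotient.mk ⟨x, hY x x.2⟩ := by
    set Q := (lowerGenerated k S n).submoduleOf (degLE k S (n + 1)) with hQ
    -- Since `E_{n+1} = E_n + L_{n+1}` and `E_n` dies in the quotient, every class has a homogeneous
    -- representative.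
    have hsurj (q : degLE k S (n + 1) ⧸ Q) : ∃ z, ∃ hz : z ∈ component k S (n + 1),
        Submodule.Quotient.mk ⟨z, component_le_degLE le_rfl hz⟩ = q := by
      obtain ⟨⟨y, hy⟩, rfl⟩ := Submodule.Quotient.mk_surjective Q q
      obtain ⟨a, ha, z, hz, rfl⟩ := Submodule.mem_sup.mp (degLE_succ_le n hy)
      refine ⟨z, hz, Eq.symm ((Submodule.Quotient.eq Q).mpr ?_)⟩
      change a + z - z ∈ lowerGenerated k S n
      rw [add_sub_cancel_right]
      exact degLE_le_lowerGenerated n ha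
    let b := Module.Basis.ofVectorSpace k (degLE k S (n + 1) ⧸ Q)
    choose z hz hzb using fun i => hsurj (b i)
    have hinj : Function.Injective z := fun i j hij => b.injective (by
      rw [← hzb, ← hzb]; congr 2)
    refine ⟨Set.range z, ?_, ?_, b.reindex (Equiv.ofInjective z hinj), ?_⟩
    · rintro _ ⟨i, rfl⟩; exact ⟨n + 1, hz i⟩
    · rintro _ ⟨i, rfl⟩; exact component_le_degLE le_rfl (hz i)
    · rintro ⟨_, i, rfl⟩
      rw [Module.Basis.reindex_apply, ← hzb]
      congr 2
      exact congrArg z ((Equiv.ofInjective z hinj).symm_apply_apply i)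
  choose Y hY using key
  -- Only the sets of index at least `1` matter; the value at `0` is a default.
  exact ⟨fun n => Y (n - 1), hY⟩

/-- A homogeneous basis representative of lower degree would lie in `E_n`, and one of higher degree,
being in `E_{n+1}`, would be zero; both have zero class, unlike a basis vector. -/
theorem IsDegreewiseBasis.mem_component [CharZero k] {X : ℕ → Set (gradedLimit k S)}
    (hX : IsDegreewiseBasis X) {n : ℕ} {x : gradedLimit k S} (hx : x ∈ X (n + 1)) :
    x ∈ component k S (n + 1) := by
  obtain ⟨hmem, b, hb⟩ := (hX n).2
  have hlow : x ∉ lowerGenerated k S n := fun h =>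
    b.ne_zero ⟨x, hx⟩ ((hb _).trans ((Submodule.Quotient.mk_eq_zero _).mpr h))
  obtain ⟨m, hm⟩ := (hX n).1 x hx
  obtain h | h | h := lt_trichotomy m (n + 1)
  · exact absurd (degLE_le_lowerGenerated n (component_le_degLE (Nat.le_of_lt_succ h) hm)) hlow
  · exact h ▸ hm
  · have h0 : toSeries k S x = 0 := by
      ext w
      by_cases hw : w.length = m
      · exact toSeries_apply_of_mem_degLE (hmem x hx) (by omega)
      · exact toSeries_mem_homogeneous hm w hw
    have : x = 0 := toSeries_injective (h0.trans (map_zero _).symm)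
    exact absurd (this ▸ zero_mem _) hlow

theorem IsDegreewiseBasis.isFreelyGeneratedBy [CharZero k] {X : ℕ → Set (gradedLimit k S)}
    (hX : IsDegreewiseBasis X) : IsFreelyGeneratedBy k (⋃ n ≥ 1, X n) := by
  classical
  have hdeg (x : ↥(⋃ n ≥ 1, X n)) : ∃ n, (x : gradedLimit k S) ∈ X (n + 1) := by
    obtain ⟨x, hx⟩ := x
    simp only [Set.mem_iUnion] at hx
    obtain ⟨n, hn, hx⟩ := hx
    exact ⟨n - 1, by rwa [Nat.sub_add_cancel hn]⟩
  choose d hd using hdeg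
  refine ⟨?_, ?_⟩
  · refine lift_injective_of_independent (d := fun x => d x + 1)
      (fun x => hX.mem_component (hd x)) (fun x => Nat.le_add_left 1 _) ?_
    intro n s c hs hc i hi
    obtain ⟨n, rfl⟩ : ∃ m, n = m + 1 := ⟨d i, (hs i hi).symm⟩
    have hs' : ∀ j ∈ s, d j = n := fun j hj => Nat.succ_injective (hs j hj)
    let Q := (lowerGenerated k S n).submoduleOf (degLE k S (n + 1))
    obtain ⟨hmem, (b : Module.Basis _ k (_ ⧸ Q)), hb⟩ := (hX n).2
    have hsn (j : s) : (j : gradedLimit k S) ∈ X (n + 1) := by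
      have := hd j; rwa [hs' j j.2] at this
    let f (j : s) : X (n + 1) := ⟨j, hsn j⟩
    have hf : Function.Injective f := fun j j' h =>
      Subtype.ext (Subtype.ext (Subtype.mk.inj h))
    -- Generators of degree at most `n` lie in `E_n`, so a relation modulo the Lie algebra they
    -- generate is a relation in `E_{n+1} / E'_{n+1}` among basis vectors.
    have hlow : ∑ j : s, c j • ((j : ↥(⋃ n ≥ 1, X n)) : gradedLimit k S) ∈
        lowerGenerated k S n := by
      refine ⟨sum_mem fun j _ => Submodule.smul_mem _ _ (hmem _ (hsn j)), ?_⟩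
      rw [Finset.sum_coe_sort s fun j => c j • (j : gradedLimit k S)]
      refine LieSubalgebra.lieSpan_mono ?_ hc
      rintro _ ⟨j, hj, rfl⟩
      exact component_le_degLE (Nat.le_of_lt_succ hj) (hX.mem_component (hd j))
    have hzero : ∑ j : s, c j • b (f j) = 0 := by
      have : ∑ j : s, c j • b (f j) =
          Q.mkQ (∑ j : s, c j • (⟨j, hmem _ (hsn j)⟩ : degLE k S (n + 1))) := by
        rw [map_sum]
        refine Finset.sum_congr rfl fun j _ => ?_
        rw [map_smul, hb]
        rfl
      rw [this]
      refine (Submodule.Quotient.mk_eq_zero Q).mpr ?_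
      change (degLE k S (n + 1)).subtype (∑ j : s, _) ∈ lowerGenerated k S n
      rw [map_sum]
      exact hlow
    exact Fintype.linearIndependent_iff.mp (b.linearIndependent.comp f hf) (fun j => c j) hzero
      ⟨i, hi⟩
  · set φ := FreeLieAlgebra.lift k fun x : ↥(⋃ n ≥ 1, X n) => (x : gradedLimit k S)
    have h : φ.range = ⊤ := hX.eq_top fun n x hx => by
      have hx' : x ∈ ⋃ n ≥ 1, X n := Set.mem_biUnion (Nat.le_add_left 1 n) hx
      exact ⟨FreeLieAlgebra.of k ⟨x, hx'⟩, FreeLieAlgebra.lift_of_apply _ _⟩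
    intro p
    have hp : p ∈ φ.range := h ▸ LieSubalgebra.mem_top p
    exact hp

end Field

end LieLimit

end

theorem mainTheorem4 (k : Type*) [Field k] [CharZero k] (S : Type*) :
    (∃ X : Set (LieLimit.gradedLimit k S),
      (∀ x ∈ X, LieLimit.IsHomogeneous x) ∧ LieLimit.IsFreelyGeneratedBy k X) ∧
    (∃ X : ℕ → Set (LieLimit.gradedLimit k S), LieLimit.IsDegreewiseBasis X) ∧
    (∀ X : ℕ → Set (LieLimit.gradedLimit k S), LieLimit.IsDegreewiseBasis X →
      LieLimit.IsFreelyGeneratedBy k (⋃ n ≥ 1, X n)) := by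
  obtain ⟨X, hX⟩ := LieLimit.exists_isDegreewiseBasis k S
  refine ⟨⟨⋃ n ≥ 1, X n, fun x hx => ?_, hX.isFreelyGeneratedBy⟩, ⟨X, hX⟩,
    fun Y hY => hY.isFreelyGeneratedBy⟩
  simp only [Set.mem_iUnion] at hx
  obtain ⟨n, hn, hx⟩ := hx
  obtain ⟨n, rfl⟩ : ∃ m, n = m + 1 := ⟨n - 1, (Nat.sub_add_cancel hn).symm⟩
  exact (hX n).1 x hx
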